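/- There are absolute constants $C,c>0$ with the following property. Let $X$ be a fixed real $n\times p$ matrix with Frobenius norm $\|X\|_F$, spectral norm $\|X\|$ and stable rank $\mathrm{sr}(X)=\|X\|_F^2/\|X\|^2$. Let $R=(R_{ij})$ be a random $p\times d$ matrix with independent real entries satisfying $\mathbb{E}[R_{ij}]=0$, $\mathbb{E}[R_{ij}^2]=1$ and $\|R_{ij}\|_{\psi_2}\le K$, where $\|x\|_{\psi_2}=\sup_{a\ge 1}a^{-1/2}(\mathbb{E}|x|^a)^{1/a}$. Let $\varepsilon\in(0,1)$ and let $k$ be an integer, $1\le k\le d$, such that $$\mathrm{sr}(X)\ \ge\ C K^4\,\frac{k}{\varepsilon^2}\,\max\Big\{1,\log\frac{d}{k}\Big\}.$$ Then, with probability at least $1-\exp\big(-c\,\varepsilon^2\,\mathrm{sr}(X)/K^4\big)$, the matrix $XR$ satisfies the $(k,\varepsilon)$-restricted isometry property scaled by $\|X\|_F$, that is, $$(1-\varepsilon)\|X\|_F\ \le\ \|XRu\|\ \le\ (1+\varepsilon)\|X\|_F$$ simultaneously for all $u\in\mathbb{R}^d$ with Euclidean norm $\|u\|=1$ and at most $k$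 nonzero coordinates. -/

import Mathlib

open MeasureTheory ProbabilityTheory

open scoped Matrix.Norms.Frobenius in
/-- The Frobenius norm of a real matrix. -/
noncomputable def frobNorm {n p : ℕ} (X : Matrix (Fin n) (Fin p) ℝ) : ℝ := ‖X‖

open scoped Matrix.Norms.L2Operator in
/-- The spectral norm of a real matrix: its operator norm between Euclidean spaces. -/
noncomputable def specNorm {n p : ℕ} (X : Matrix (Fin n) (Fin p) ℝ) : ℝ := ‖X‖

/-- The stable rank, the squared ratio of the Frobenius norm and the spectral norm. -/
noncomputable def stableRank {n p : ℕ} (X : Matrix (Fin n) (Fin p) ℝ) : ℝ :=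
  frobNorm X ^ 2 / specNorm X ^ 2

/-- The `ψ₂`-norm `sup_{a ≥ 1} a^{-1/2} (E|x|^a)^{1/a}` of a real random variable, with values
in `[0, ∞]`. -/
noncomputable def psi2Norm {Ω : Type*} [MeasurableSpace Ω] (x : Ω → ℝ) (μ : Measure Ω) :
    ENNReal :=
  ⨆ (a : ℝ) (_ : 1 ≤ a),
    ENNReal.ofReal (a ^ (-(1 / 2) : ℝ)) * eLpNorm x (ENNReal.ofReal a) μ

/-- The vector `u` has at most `k` nonzero coordinates. -/
def IsSparse {d : ℕ} (k : ℕ) (u : EuclideanSpace ℝ (Fin d)) : Prop :=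
  {i : Fin d | u i ≠ 0}.ncard ≤ k

/-- The matrix `M` satisfies the `(k, ε)`-restricted isometry property with scaling factor `s`:
`(1 - ε) s ≤ ‖M u‖ ≤ (1 + ε) s` for every `k`-sparse Euclidean unit vector `u`. -/
def HasScaledRIP {n d : ℕ} (M : Matrix (Fin n) (Fin d) ℝ) (s : ℝ) (k : ℕ) (ε : ℝ) : Prop :=
  ∀ u : EuclideanSpace ℝ (Fin d), ‖u‖ = 1 → IsSparse k u →
    (1 - ε) * s ≤ ‖WithLp.toLp 2 (M.mulVec u.ofLp)‖ ∧
      ‖WithLp.toLp 2 (M.mulVec u.ofLp)‖ ≤ (1 + ε) * s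

/-! For a fixed unit vector `u`, the coordinates of `R u` are independent, centred, of variance one
and sub-Gaussian at scale `K`. So `‖X R u‖²` is a positive semidefinite quadratic form in
independent variables, with mean `‖X‖_F²`. A Hanson–Wright bound shows that it deviates by a
relative amount `δ` with probability at most `2 exp(-c δ² sr(X) / K⁴)`
(`measure_norm_deviation_le`). Nets in the `k`-dimensional coordinate subspaces reduce all sparse
vectors to finitely many (`exists_finset_hasScaledRIP`). Their number is at most exponential in `k
max{1, log(d/k)}` (`card_net_mul_le_exp`), and the assumption on `sr(X)` lets half of the deviation
exponent pay for the union bound.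

The Hanson–Wright bound comes from a self-bounding argument for the moment generating function `F`
of the centred form (`integral_exp_quadForm_le`). Cauchy–Schwarz separates the diagonal, handled by
Bernstein, from the off-diagonal part, which is decoupled by averaging over bipartitions of the
indices. Integrating out one side of a bipartition leaves the exponential of a multiple of `‖X
x_I‖²`. By Jensen this is at most an exponential moment of the whole form, with a coefficient
quadratic in `l` (`lintegral_exp_bipartite_le`). Hence `F(l)² ≤ exp(β) max(1, F(|l|))` with `β` of
order `l²`, which closes up to `F(l) ≤ exp(β)`. -/

open Matrix

/-! ### Equivalent forms of sub-Gaussianity -/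

/-- A factorial bound on the even moments bounds the exponential moment of the square. -/
theorem integrable_exp_sq_of_moment_le {Ω : Type*} [MeasurableSpace Ω] {μ : Measure Ω}
    {x : Ω → ℝ} (hx : AEMeasurable x μ) {B : ℝ} (hB : 0 < B)
    (h : ∀ m : ℕ, ∫⁻ ω, ENNReal.ofReal (x ω ^ (2 * m)) ∂μ ≤
      ENNReal.ofReal ((m.factorial : ℝ) * B ^ m)) :
    Integrable (fun ω => Real.exp (x ω ^ 2 / (2 * B))) μ ∧
      ∫ ω, Real.exp (x ω ^ 2 / (2 * B)) ∂μ ≤ 2 := by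
  have key : ∫⁻ ω, ENNReal.ofReal (Real.exp (x ω ^ 2 / (2 * B))) ∂μ ≤ ENNReal.ofReal 2 := by
    have e1 : ∀ ω, ENNReal.ofReal (Real.exp (x ω ^ 2 / (2 * B))) =
        ∑' m : ℕ, ENNReal.ofReal (((m.factorial : ℝ) * (2 * B) ^ m)⁻¹) *
          ENNReal.ofReal (x ω ^ (2 * m)) := by
      intro ω
      have hs := NormedSpace.expSeries_div_hasSum_exp (x ω ^ 2 / (2 * B))
      rw [← Real.exp_eq_exp_ℝ] at hs
      rw [← hs.tsum_eq, ENNReal.ofReal_tsum_of_nonneg _ hs.summable]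
      · refine tsum_congr fun m => ?_
        rw [← ENNReal.ofReal_mul (by positivity)]
        congr 1
        rw [div_pow, ← pow_mul]
        field_simp
      · intro m
        positivity
    simp_rw [e1]
    rw [lintegral_tsum (fun m => by fun_prop)]
    -- The doubled `B` in the exponent turns the moment bound into a geometric series of ratio `1/2`
    -- and sum `2`.
    have e2 : ∀ m : ℕ, ∫⁻ ω, ENNReal.ofReal (((m.factorial : ℝ) * (2 * B) ^ m)⁻¹) *
          ENNReal.ofReal (x ω ^ (2 * m)) ∂μ ≤ ENNReal.ofReal ((1 / 2) ^ m) := by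
      intro m
      rw [lintegral_const_mul'' _ (by fun_prop)]
      refine (mul_le_mul_right (h m) _).trans ?_
      rw [← ENNReal.ofReal_mul (by positivity)]
      apply ENNReal.ofReal_le_ofReal
      apply le_of_eq
      have : (m.factorial : ℝ) ≠ 0 := by positivity
      rw [mul_pow, div_pow, one_pow]
      field_simp
    refine (ENNReal.tsum_le_tsum e2).trans ?_
    rw [← ENNReal.ofReal_tsum_of_nonneg (fun m => by positivity) summable_geometric_two,
      tsum_geometric_two]
  have hm : AEStronglyMeasurable (fun ω => Real.exp (x ω ^ 2 / (2 * B))) μ :=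
    AEMeasurable.aestronglyMeasurable (by fun_prop)
  refine ⟨⟨hm, ?_⟩, ?_⟩
  · rw [hasFiniteIntegral_iff_ofReal (ae_of_all _ fun ω => by positivity)]
    exact key.trans_lt ENNReal.ofReal_lt_top
  · rw [integral_eq_lintegral_of_nonneg_ae (ae_of_all _ fun ω => by positivity) hm]
    exact ENNReal.toReal_le_of_le_ofReal (by norm_num) key

/-- `m ^ m / m!` is one term of the series of `exp m`, and `e < 3`. -/
theorem pow_self_le_factorial_mul (m : ℕ) : (m : ℝ) ^ m ≤ m.factorial * 3 ^ m := by
  have h := Real.pow_div_factorial_le_exp m (by positivity) m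
  have h3 : Real.exp m ≤ 3 ^ m := by
    have := Real.exp_one_lt_three
    calc Real.exp m = Real.exp 1 ^ m := by rw [← Real.exp_nat_mul, mul_one]
      _ ≤ 3 ^ m := by gcongr
  rw [div_le_iff₀ (by positivity)] at h
  nlinarith [Nat.cast_pos (α := ℝ).2 m.factorial_pos]

/-- The moment definition of the `ψ₂` norm bounds the exponential moment of the square. -/
theorem integrable_exp_sq_of_psi2Norm_le {Ω : Type*} [MeasurableSpace Ω] {μ : Measure Ω}
    [IsProbabilityMeasure μ] {x : Ω → ℝ} (hx : AEMeasurable x μ) {K : ℝ} (hK : 0 < K)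
    (h : psi2Norm x μ ≤ ENNReal.ofReal K) :
    Integrable (fun ω => Real.exp (x ω ^ 2 / (12 * K ^ 2))) μ ∧
      ∫ ω, Real.exp (x ω ^ 2 / (12 * K ^ 2)) ∂μ ≤ 2 := by
  -- The exponent `a = 2m` gives `E x^(2m) ≤ (2m)^m K^(2m)`, and `m^m ≤ m! 3^m` yields `B = 6K²`.
  have := integrable_exp_sq_of_moment_le hx (B := 6 * K ^ 2) (by positivity) ?_
  · simpa only [← mul_assoc, show (2 * 6 : ℝ) = 12 by norm_num] using this
  intro m
  rcases Nat.eq_zero_or_pos m with rfl | hm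
  · simp
  have hm1 : (1 : ℝ) ≤ m := by exact_mod_cast hm
  have hp : (1 : ℝ) ≤ 2 * m := by linarith
  have hp0 : (0 : ℝ) < 2 * m := by linarith
  have h1 : ENNReal.ofReal ((2 * m : ℝ) ^ (-(1 / 2) : ℝ)) * eLpNorm x (ENNReal.ofReal (2 * m)) μ ≤
      ENNReal.ofReal K := (le_iSup₂_of_le (2 * m : ℝ) hp le_rfl).trans h
  rw [eLpNorm_eq_lintegral_rpow_enorm_toReal (ENNReal.ofReal_pos.2 hp0).ne' ENNReal.ofReal_ne_top,
    ENNReal.toReal_ofReal hp0.le] at h1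
  have h2 := ENNReal.rpow_le_rpow h1 hp0.le
  rw [ENNReal.mul_rpow_of_nonneg _ _ hp0.le, ← ENNReal.rpow_mul, one_div_mul_cancel hp0.ne',
    ENNReal.rpow_one, ENNReal.ofReal_rpow_of_pos (by positivity),
    ENNReal.ofReal_rpow_of_pos hK, ← Real.rpow_mul hp0.le] at h2
  have e1 : ∀ ω, ‖x ω‖ₑ ^ (2 * m : ℝ) = ENNReal.ofReal (x ω ^ (2 * m)) := by
    intro ω
    rw [← ofReal_norm, ENNReal.ofReal_rpow_of_nonneg (norm_nonneg _) hp0.le]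
    congr 1
    have : (2 * m : ℝ) = ((2 * m : ℕ) : ℝ) := by push_cast; ring
    rw [this, Real.rpow_natCast, Real.norm_eq_abs, pow_mul, sq_abs, ← pow_mul]
  simp_rw [e1] at h2
  have e2 : (2 * m : ℝ) ^ (-(1 / 2) * (2 * m) : ℝ) = ((2 * m : ℝ) ^ m)⁻¹ := by
    rw [show (-(1 / 2) * (2 * m) : ℝ) = -(m : ℝ) by ring, Real.rpow_neg hp0.le, Real.rpow_natCast]
  have e3 : K ^ (2 * m : ℝ) = K ^ (2 * m) := by
    rw [← Real.rpow_natCast]; push_cast; rfl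
  rw [e2, e3] at h2
  have h3 : ∫⁻ ω, ENNReal.ofReal (x ω ^ (2 * m)) ∂μ =
      ENNReal.ofReal ((2 * m : ℝ) ^ m) * (ENNReal.ofReal (((2 * m : ℝ) ^ m)⁻¹) *
        ∫⁻ ω, ENNReal.ofReal (x ω ^ (2 * m)) ∂μ) := by
    rw [← mul_assoc, ← ENNReal.ofReal_mul (by positivity), mul_inv_cancel₀ (by positivity)]
    simp
  rw [h3]
  refine (mul_le_mul_right h2 _).trans ?_
  rw [← ENNReal.ofReal_mul (by positivity)]
  apply ENNReal.ofReal_le_ofReal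
  have := pow_self_le_factorial_mul m
  calc (2 * m : ℝ) ^ m * K ^ (2 * m) = (m : ℝ) ^ m * (2 * K ^ 2) ^ m := by
        rw [mul_pow, mul_pow, ← pow_mul]; ring
    _ ≤ (m.factorial * 3 ^ m) * (2 * K ^ 2) ^ m := by gcongr
    _ = m.factorial * (6 * K ^ 2) ^ m := by
        rw [mul_assoc, ← mul_pow]; ring

/-- A random variable with sub-Gaussian moment generating function has a square with a bounded
exponential moment. -/
theorem integrable_exp_sq_of_exp_mul_le {Ω : Type*} [MeasurableSpace Ω] {μ : Measure Ω}
    [IsProbabilityMeasure μ] {x : Ω → ℝ} {L : ℝ} (hL : 0 < L) (hx : AEMeasurable x μ)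
    (hi : ∀ t : ℝ, Integrable (fun ω => Real.exp (t * x ω)) μ)
    (h : ∀ t : ℝ, ∫ ω, Real.exp (t * x ω) ∂μ ≤ Real.exp (L * t ^ 2)) :
    Integrable (fun ω => Real.exp (x ω ^ 2 / (24 * L))) μ ∧
      ∫ ω, Real.exp (x ω ^ 2 / (24 * L)) ∂μ ≤ 2 := by
  have := integrable_exp_sq_of_moment_le hx (B := 12 * L) (by positivity) ?_
  · simpa only [← mul_assoc, show (2 * 12 : ℝ) = 24 by norm_num] using this
  intro m
  rcases Nat.eq_zero_or_pos m with rfl | hm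
  · simp
  have hm0 : (0 : ℝ) < m := by exact_mod_cast hm
  -- This `t` minimises `t^(-2m) exp(L t²)`, the bound that the moment generating function gives for
  -- the moment of order `2m`.
  set t : ℝ := √(m / L) with ht
  have ht2 : t ^ 2 = m / L := Real.sq_sqrt (by positivity)
  have ht0 : 0 < t := Real.sqrt_pos.2 (by positivity)
  set c : ℝ := (2 * m).factorial * (L / m) ^ m with hc
  have hpt : ∀ ω, x ω ^ (2 * m) ≤ c * (Real.exp (t * x ω) + Real.exp (-t * x ω)) := by
    intro ω
    have h1 := Real.pow_div_factorial_le_exp (|t * x ω|) (abs_nonneg _) (2 * m)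
    rw [pow_mul, sq_abs, mul_pow, mul_pow, ht2, ← pow_mul, div_le_iff₀ (by positivity)] at h1
    have h2 : Real.exp |t * x ω| ≤ Real.exp (t * x ω) + Real.exp (-t * x ω) := by
      rw [neg_mul]
      rcases abs_cases (t * x ω) with ⟨e, _⟩ | ⟨e, _⟩ <;> rw [e]
      · linarith [Real.exp_pos (-(t * x ω))]
      · linarith [Real.exp_pos (t * x ω)]
    calc x ω ^ (2 * m) = (L / m) ^ m * ((m / L) ^ m * x ω ^ (2 * m)) := by
          rw [← mul_assoc, ← mul_pow]
          field_simp
          simp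
      _ ≤ (L / m) ^ m * (Real.exp |t * x ω| * (2 * m).factorial) := by gcongr
      _ = c * Real.exp |t * x ω| := by ring
      _ ≤ _ := by gcongr
  calc ∫⁻ ω, ENNReal.ofReal (x ω ^ (2 * m)) ∂μ
      ≤ ∫⁻ ω, ENNReal.ofReal (c * (Real.exp (t * x ω) + Real.exp (-t * x ω))) ∂μ :=
        lintegral_mono fun ω => ENNReal.ofReal_le_ofReal (hpt ω)
    _ = ENNReal.ofReal (∫ ω, c * (Real.exp (t * x ω) + Real.exp (-t * x ω)) ∂μ) := by
        refine (ofReal_integral_eq_lintegral_ofReal ?_ (ae_of_all _ fun ω => by positivity)).symm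
        exact ((hi t).add (hi (-t))).const_mul c
    _ ≤ _ := by
        apply ENNReal.ofReal_le_ofReal
        rw [integral_const_mul, integral_add (hi t) (hi (-t))]
        have h1 := h t
        have h2 := h (-t)
        rw [neg_sq] at h2
        have e : L * t ^ 2 = m := by rw [ht2]; field_simp
        rw [e] at h1 h2
        have h3 : Real.exp m ≤ 3 ^ m := by
          calc Real.exp m = Real.exp 1 ^ m := by rw [← Real.exp_nat_mul, mul_one]
            _ ≤ 3 ^ m := by gcongr; exact Real.exp_one_lt_three.le
        have h4 : (2 : ℝ) ≤ 2 ^ m := by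
          calc (2 : ℝ) = 2 ^ 1 := by norm_num
            _ ≤ 2 ^ m := by gcongr; norm_num; exact hm
        have h5 : ((2 * m).factorial : ℝ) ≤ (2 * m) ^ m * m.factorial := by
          exact_mod_cast Nat.factorial_two_mul_le m
        calc c * _ ≤ c * (Real.exp m + Real.exp m) := by gcongr
          _ ≤ ((2 * m) ^ m * m.factorial * (L / m) ^ m) * (2 ^ m * 3 ^ m) := by
            have hexp := Real.exp_pos m
            rw [hc]
            gcongr
            nlinarith
          _ = m.factorial * (12 * L) ^ m := by
            rw [mul_pow, div_pow, mul_pow, show (12 : ℝ) = 2 * 2 * 3 by norm_num, mul_pow, mul_pow]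
            field_simp

/-- The point is the linear term with coefficient one: it vanishes on integrating a centred
variable, leaving only the exponential of a square. -/
theorem exp_le_add_exp_sq (y : ℝ) : Real.exp y ≤ y + Real.exp (y ^ 2) := by
  have h1 := Real.add_one_le_exp (y ^ 2)
  rcases le_or_gt |y| 1 with h | h
  · have := (abs_le.1 (Real.abs_exp_sub_one_sub_id_le h)).2
    linarith
  · rcases lt_abs.1 h with h | h
    · have : Real.exp y ≤ Real.exp (y ^ 2) := Real.exp_le_exp.2 (by nlinarith)
      linarith
    · have : Real.exp y ≤ 1 := Real.exp_le_one_iff.2 (by linarith)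
      nlinarith

theorem exp_mul_le_one_sub_add {θ : ℝ} (h0 : 0 ≤ θ) (h1 : θ ≤ 1) (w : ℝ) :
    Real.exp (θ * w) ≤ 1 - θ + θ * Real.exp w := by
  have := convexOn_exp.2 (Set.mem_univ (0 : ℝ)) (Set.mem_univ w) (sub_nonneg.2 h1) h0 (by ring)
  simpa using this

/-- Convexity of `exp` along the chord from `0` to `w`: shrinking the exponent by `θ` improves the
bound `2` to `1 + θ`. -/
theorem integral_exp_mul_le_one_add {Ω : Type*} [MeasurableSpace Ω] {μ : Measure Ω}
    [IsProbabilityMeasure μ] {w : Ω → ℝ} (hw : AEMeasurable w μ)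
    (hi : Integrable (fun ω => Real.exp (w ω)) μ) (h : ∫ ω, Real.exp (w ω) ∂μ ≤ 2)
    {θ : ℝ} (h0 : 0 ≤ θ) (h1 : θ ≤ 1) :
    Integrable (fun ω => Real.exp (θ * w ω)) μ ∧ ∫ ω, Real.exp (θ * w ω) ∂μ ≤ 1 + θ := by
  have hb : Integrable (fun ω => 1 - θ + θ * Real.exp (w ω)) μ :=
    (integrable_const _).add (hi.const_mul θ)
  have hI : Integrable (fun ω => Real.exp (θ * w ω)) μ := by
    refine hb.mono' (AEMeasurable.aestronglyMeasurable (by fun_prop)) (ae_of_all _ fun ω => ?_)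
    rw [Real.norm_of_nonneg (Real.exp_pos _).le]
    exact exp_mul_le_one_sub_add h0 h1 _
  refine ⟨hI, ?_⟩
  calc ∫ ω, Real.exp (θ * w ω) ∂μ ≤ ∫ ω, (1 - θ + θ * Real.exp (w ω)) ∂μ :=
        integral_mono hI hb fun ω => exp_mul_le_one_sub_add h0 h1 _
    _ = 1 - θ + θ * ∫ ω, Real.exp (w ω) ∂μ := by
        rw [integral_add (integrable_const _) (hi.const_mul θ), integral_const_mul]
        simp
    _ ≤ 1 + θ := by nlinarith

theorem integrable_sq_of_exp_sq {Ω : Type*} [MeasurableSpace Ω] {μ : Measure Ω}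
    {x : Ω → ℝ} {L : ℝ} (hL : 0 < L) (hx : AEMeasurable x μ)
    (hi : Integrable (fun ω => Real.exp (x ω ^ 2 / L)) μ) : Integrable (fun ω => x ω ^ 2) μ := by
  refine (hi.const_mul L).mono' (AEMeasurable.aestronglyMeasurable (by fun_prop))
    (ae_of_all _ fun ω => ?_)
  rw [Real.norm_of_nonneg (by positivity)]
  have := Real.add_one_le_exp (x ω ^ 2 / L)
  calc x ω ^ 2 = L * (x ω ^ 2 / L) := by field_simp
    _ ≤ _ := by gcongr; linarith

/-- A centred random variable whose square has a bounded exponential moment is sub-Gaussian. -/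
theorem integral_exp_mul_le_of_exp_sq {Ω : Type*} [MeasurableSpace Ω] {μ : Measure Ω}
    [IsProbabilityMeasure μ] {x : Ω → ℝ} {L : ℝ} (hL : 0 < L) (hx : AEMeasurable x μ)
    (hi : Integrable (fun ω => Real.exp (x ω ^ 2 / L)) μ)
    (h : ∫ ω, Real.exp (x ω ^ 2 / L) ∂μ ≤ 2) (h0 : ∫ ω, x ω ∂μ = 0) (t : ℝ) :
    Integrable (fun ω => Real.exp (t * x ω)) μ ∧
      ∫ ω, Real.exp (t * x ω) ∂μ ≤ Real.exp (L * t ^ 2) := by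
  have hw : AEMeasurable (fun ω => x ω ^ 2 / L) μ := by fun_prop
  have hm : AEStronglyMeasurable (fun ω => Real.exp (t * x ω)) μ :=
    AEMeasurable.aestronglyMeasurable (by fun_prop)
  -- For small `t` the mean zero condition removes the linear term. For large `t` it is not needed:
  -- `t x ≤ L t²/2 + x²/(2L)`, and the resulting constant `3/2` is at most `exp(L t²/2)`.
  rcases le_or_gt (L * t ^ 2) 1 with ht | ht
  · obtain ⟨hI, hle⟩ := integral_exp_mul_le_one_add hw hi h (θ := L * t ^ 2) (by positivity) ht
    have hxi : Integrable x μ := by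
      refine ((integrable_const (1 : ℝ)).add (integrable_sq_of_exp_sq hL hx hi)).mono'
        hx.aestronglyMeasurable (ae_of_all _ fun ω => ?_)
      rw [Real.norm_eq_abs, Pi.add_apply, ← sq_abs (x ω)]
      nlinarith [sq_nonneg (|x ω| - 1)]
    have hb := (hxi.const_mul t).add hI
    have hpt : ∀ ω, Real.exp (t * x ω) ≤ t * x ω + Real.exp (L * t ^ 2 * (x ω ^ 2 / L)) := by
      intro ω
      convert exp_le_add_exp_sq (t * x ω) using 3
      field_simp
    have hI2 : Integrable (fun ω => Real.exp (t * x ω)) μ := by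
      refine hb.mono' hm (ae_of_all _ fun ω => ?_)
      rw [Real.norm_of_nonneg (Real.exp_pos _).le]
      exact hpt ω
    refine ⟨hI2, (integral_mono hI2 hb hpt).trans ?_⟩
    simp only [Pi.add_apply]
    rw [integral_add (hxi.const_mul t) hI, integral_const_mul, h0]
    linarith [Real.add_one_le_exp (L * t ^ 2)]
  · obtain ⟨hI, hle⟩ := integral_exp_mul_le_one_add hw hi h (θ := 1 / 2) (by norm_num) (by norm_num)
    have hb := hI.const_mul (Real.exp (L * t ^ 2 / 2))
    have hpt : ∀ ω, Real.exp (t * x ω) ≤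
        Real.exp (L * t ^ 2 / 2) * Real.exp (1 / 2 * (x ω ^ 2 / L)) := by
      intro ω
      rw [← Real.exp_add]
      apply Real.exp_le_exp.2
      have : L * t ^ 2 / 2 + 1 / 2 * (x ω ^ 2 / L) - t * x ω = (L * t - x ω) ^ 2 / (2 * L) := by
        field_simp
        ring
      have : 0 ≤ (L * t - x ω) ^ 2 / (2 * L) := by positivity
      linarith
    have hI2 : Integrable (fun ω => Real.exp (t * x ω)) μ := by
      refine hb.mono' hm (ae_of_all _ fun ω => ?_)
      rw [Real.norm_of_nonneg (Real.exp_pos _).le]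
      exact hpt ω
    refine ⟨hI2, (integral_mono hI2 hb hpt).trans ?_⟩
    rw [integral_const_mul]
    calc _ ≤ Real.exp (L * t ^ 2 / 2) * Real.exp (L * t ^ 2 / 2) := by
          gcongr
          linarith [Real.add_one_le_exp (L * t ^ 2 / 2)]
      _ = _ := by rw [← Real.exp_add]; ring_nf

/-! ### Bernstein bound for squares and standardised sub-Gaussian laws -/

/-- The second-order Taylor remainder, taken from the complex exponential. -/
theorem exp_le_one_add_add_sq_mul_exp_abs (v : ℝ) :
    Real.exp v ≤ 1 + v + v ^ 2 * Real.exp |v| := by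
  have := Complex.norm_exp_sub_sum_le_norm_mul_exp (v : ℂ) 2
  simp only [Finset.sum_range_succ, Finset.sum_range_zero, pow_zero, Nat.factorial, pow_one,
    Nat.cast_one, div_one, zero_add, mul_one, Complex.norm_real, Real.norm_eq_abs, sq_abs] at this
  have h2 : Complex.exp v - (1 + v) = ((Real.exp v - (1 + v) : ℝ) : ℂ) := by push_cast; rfl
  rw [h2, Complex.norm_real, Real.norm_eq_abs] at this
  linarith [(abs_le.1 this).2]

/-- The Bernstein bound for the centred square of a variance one random variable. -/
theorem integral_exp_mul_sq_sub_one_le {Ω : Type*} [MeasurableSpace Ω] {μ : Measure Ω}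
    [IsProbabilityMeasure μ] {x : Ω → ℝ} {M : ℝ} (hM : 1 ≤ M) (hx : AEMeasurable x μ)
    (hi : Integrable (fun ω => Real.exp (x ω ^ 2 / M)) μ)
    (h : ∫ ω, Real.exp (x ω ^ 2 / M) ∂μ ≤ 2) (h2 : ∫ ω, x ω ^ 2 ∂μ = 1) {s : ℝ}
    (hs : |s| ≤ 1 / (2 * M)) :
    Integrable (fun ω => Real.exp (s * (x ω ^ 2 - 1))) μ ∧
      ∫ ω, Real.exp (s * (x ω ^ 2 - 1)) ∂μ ≤ Real.exp (48 * M ^ 2 * s ^ 2) := by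
  have hM0 : 0 < M := by linarith
  have hsq := integrable_sq_of_exp_sq hM0 hx hi
  have hpt : ∀ ω, Real.exp (s * (x ω ^ 2 - 1)) ≤
      1 + s * (x ω ^ 2 - 1) + 24 * M ^ 2 * s ^ 2 * Real.exp (x ω ^ 2 / M) := by
    intro ω
    set Y := x ω ^ 2 - 1 with hY
    have hYa : |Y| ≤ x ω ^ 2 + 1 := by
      rw [abs_le]
      constructor <;> nlinarith [sq_nonneg (x ω)]
    have hv : |s * Y| ≤ |Y| / (2 * M) := by
      rw [abs_mul, div_eq_mul_one_div, mul_comm]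
      gcongr
    -- The available factor `exp(|Y|/M)` is split in two halves: one absorbs `Y²`, the other
    -- dominates `exp |sY|`.
    have hq := Real.pow_div_factorial_le_exp (|Y| / (2 * M)) (by positivity) 2
    have hq' : Y ^ 2 ≤ 8 * M ^ 2 * Real.exp (|Y| / (2 * M)) := by
      rw [div_pow, sq_abs, show (Nat.factorial 2 : ℝ) = 2 by norm_num [Nat.factorial]] at hq
      have : Y ^ 2 = 8 * M ^ 2 * (Y ^ 2 / (2 * M) ^ 2 / 2) := by field_simp; ring
      rw [this]
      gcongr
    have he : Real.exp (|Y| / M) ≤ 3 * Real.exp (x ω ^ 2 / M) := by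
      calc Real.exp (|Y| / M) ≤ Real.exp (1 + x ω ^ 2 / M) := by
            apply Real.exp_le_exp.2
            rw [div_le_iff₀ hM0, add_mul, div_mul_cancel₀ _ hM0.ne']
            linarith
        _ = Real.exp 1 * Real.exp (x ω ^ 2 / M) := Real.exp_add _ _
        _ ≤ _ := by gcongr; exact Real.exp_one_lt_three.le
    refine (exp_le_one_add_add_sq_mul_exp_abs _).trans (add_le_add_right ?_ _)
    calc (s * Y) ^ 2 * Real.exp |s * Y|
        ≤ s ^ 2 * (8 * M ^ 2 * Real.exp (|Y| / (2 * M))) * Real.exp (|Y| / (2 * M)) := by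
          rw [mul_pow]; gcongr
      _ = s ^ 2 * (8 * M ^ 2) * Real.exp (|Y| / M) := by
          rw [mul_assoc, mul_assoc, mul_assoc, ← Real.exp_add, ← mul_assoc (8 : ℝ), ← mul_assoc]
          congr 2
          field_simp
          ring
      _ ≤ s ^ 2 * (8 * M ^ 2) * (3 * Real.exp (x ω ^ 2 / M)) := by gcongr
      _ = _ := by ring
  have hsq1 : Integrable (fun ω => s * (x ω ^ 2 - 1)) μ :=
    (hsq.sub (integrable_const _)).const_mul s
  have hb1 : Integrable (fun ω => 1 + s * (x ω ^ 2 - 1)) μ :=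
    (integrable_const _).add hsq1
  have hb2 := hi.const_mul (24 * M ^ 2 * s ^ 2)
  have hb := hb1.add hb2
  have hI : Integrable (fun ω => Real.exp (s * (x ω ^ 2 - 1))) μ := by
    refine hb.mono' (AEMeasurable.aestronglyMeasurable (by fun_prop)) (ae_of_all _ fun ω => ?_)
    rw [Real.norm_of_nonneg (Real.exp_pos _).le]
    exact hpt ω
  refine ⟨hI, (integral_mono hI hb hpt).trans ?_⟩
  simp only [Pi.add_apply]
  rw [integral_add hb1 hb2, integral_add (integrable_const _) hsq1,
    integral_const_mul, integral_const_mul,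
    integral_sub hsq (integrable_const _), h2]
  simp only [integral_const, probReal_univ, smul_eq_mul, mul_one, sub_self, mul_zero, add_zero]
  have h0 : 0 ≤ 24 * M ^ 2 * s ^ 2 := by positivity
  nlinarith [Real.add_one_le_exp (48 * M ^ 2 * s ^ 2)]

/-- A centred law on `ℝ` of variance one which is sub-Gaussian with parameter `L` and whose square
has a bounded exponential moment at scale `M`. -/
structure IsSubgaussianLaw (ν : Measure ℝ) (L M : ℝ) : Prop where
  integral_id : ∫ x, x ∂ν = 0
  integral_sq : ∫ x, x ^ 2 ∂ν = 1
  integrable_exp_mul : ∀ t : ℝ, Integrable (fun x => Real.exp (t * x)) ν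
  integral_exp_mul_le : ∀ t : ℝ, ∫ x, Real.exp (t * x) ∂ν ≤ Real.exp (L * t ^ 2)
  integrable_exp_sq : Integrable (fun x => Real.exp (x ^ 2 / M)) ν
  integral_exp_sq_le : ∫ x, Real.exp (x ^ 2 / M) ∂ν ≤ 2

/-- Jensen for a centred law, via the tangent line of `exp` at `0`. It serves to put integrated-out
coordinates back into the quadratic form. -/
theorem IsSubgaussianLaw.one_le_integral_exp_mul {ν : Measure ℝ} [IsProbabilityMeasure ν] {L M : ℝ}
    (h : IsSubgaussianLaw ν L M) (hM : 0 < M) (t : ℝ) : 1 ≤ ∫ x, Real.exp (t * x) ∂ν := by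
  have hsq := integrable_sq_of_exp_sq hM aemeasurable_id h.integrable_exp_sq
  have hxi : Integrable (fun x : ℝ => x) ν := by
    refine ((integrable_const (1 : ℝ)).add hsq).mono' aestronglyMeasurable_id
      (ae_of_all _ fun x => ?_)
    simp only [Real.norm_eq_abs, Pi.add_apply, id]
    rw [← sq_abs x]
    nlinarith [sq_nonneg (|x| - 1)]
  calc (1 : ℝ) = ∫ x, (t * x + 1) ∂ν := by
        rw [integral_add (hxi.const_mul t) (integrable_const _), integral_const_mul, h.integral_id]
        simp
    _ ≤ _ := integral_mono ((hxi.const_mul t).add (integrable_const _)) (h.integrable_exp_mul t)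
        fun x => Real.add_one_le_exp (t * x)

/-! ### Product laws and decoupling -/

section Pi

variable {ι : Type*} [Fintype ι] [DecidableEq ι] (ν : ι → Measure ℝ)
  [∀ i, IsProbabilityMeasure (ν i)]

/-- Mixing the coordinates of two independent samples of a product law yields the same law. -/
theorem measurePreserving_piecewise (I : Finset ι) :
    MeasurePreserving (fun z : (ι → ℝ) × (ι → ℝ) => I.piecewise z.1 z.2)
      ((Measure.pi ν).prod (Measure.pi ν)) (Measure.pi ν) := by
  have hm : Measurable (fun z : (ι → ℝ) × (ι → ℝ) => I.piecewise z.1 z.2) := by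
    refine measurable_pi_iff.2 fun i => ?_
    by_cases hi : i ∈ I <;> simp only [Finset.piecewise, hi, if_true, if_false] <;> fun_prop
  refine ⟨hm, (Measure.pi_eq fun s hs => ?_).symm⟩
  rw [Measure.map_apply hm (MeasurableSet.univ_pi hs)]
  have : (fun z : (ι → ℝ) × (ι → ℝ) => I.piecewise z.1 z.2) ⁻¹' Set.univ.pi s =
      (Set.univ.pi fun i => if i ∈ I then s i else Set.univ) ×ˢ
        (Set.univ.pi fun i => if i ∈ I then Set.univ else s i) := by
    ext z
    simp only [Set.mem_preimage, Set.mem_pi, Set.mem_univ, true_implies, Set.mem_prod,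
      ← forall_and]
    refine forall_congr' fun i => ?_
    by_cases hi : i ∈ I <;> simp [Finset.piecewise, hi]
  rw [this, Measure.prod_prod, Measure.pi_pi, Measure.pi_pi, ← Finset.prod_mul_distrib]
  refine Finset.prod_congr rfl fun i _ => ?_
  by_cases hi : i ∈ I <;> simp [hi]

variable {ν}

theorem lintegral_exp_dotProduct (hi : ∀ i (t : ℝ), Integrable (fun x => Real.exp (t * x)) (ν i))
    (t : ι → ℝ) :
    ∫⁻ y, ENNReal.ofReal (Real.exp (t ⬝ᵥ y)) ∂Measure.pi ν =
      ENNReal.ofReal (∏ i, ∫ x, Real.exp (t i * x) ∂ν i) := by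
  simp only [dotProduct, Real.exp_sum]
  rw [← ofReal_integral_eq_lintegral_ofReal]
  · rw [integral_fintype_prod_eq_prod (fun i x => Real.exp (t i * x))]
  · exact Integrable.fintype_prod_dep (f := fun i x => Real.exp (t i * x)) fun i => hi i (t i)
  · exact ae_of_all _ fun y => Finset.prod_nonneg fun i _ => (Real.exp_pos _).le

theorem lintegral_exp_dotProduct_le {L M : ℝ} (h : ∀ i, IsSubgaussianLaw (ν i) L M) (t : ι → ℝ) :
    ∫⁻ y, ENNReal.ofReal (Real.exp (t ⬝ᵥ y)) ∂Measure.pi ν ≤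
      ENNReal.ofReal (Real.exp (L * (t ⬝ᵥ t))) := by
  rw [lintegral_exp_dotProduct fun i => (h i).integrable_exp_mul]
  apply ENNReal.ofReal_le_ofReal
  rw [dotProduct, Finset.mul_sum, Real.exp_sum]
  refine Finset.prod_le_prod (fun i _ => integral_nonneg fun x => (Real.exp_pos _).le) fun i _ => ?_
  rw [← pow_two]
  exact (h i).integral_exp_mul_le _

theorem one_le_lintegral_exp_dotProduct {L M : ℝ} (hM : 0 < M)
    (h : ∀ i, IsSubgaussianLaw (ν i) L M) (t : ι → ℝ) :
    1 ≤ ∫⁻ y, ENNReal.ofReal (Real.exp (t ⬝ᵥ y)) ∂Measure.pi ν := by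
  rw [lintegral_exp_dotProduct fun i => (h i).integrable_exp_mul, ENNReal.one_le_ofReal]
  calc (1 : ℝ) = ∏ _i : ι, 1 := by simp
    _ ≤ _ := Finset.prod_le_prod (fun _ _ => zero_le_one)
      fun i _ => (h i).one_le_integral_exp_mul hM (t i)

/-- Erasing `i` is a bijection from these sets onto the subsets of the complement of `{i, j}`. In
probabilistic terms, a uniform random set separates `i` from `j` in this order with probability
`1/4`. -/
theorem four_mul_card_separating {i j : ι} (hij : i ≠ j) :
    4 * (Finset.univ.filter fun I : Finset ι => i ∈ I ∧ j ∉ I).card = 2 ^ Fintype.card ι := by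
  have h1 : (Finset.univ.filter fun I : Finset ι => i ∈ I ∧ j ∉ I).card =
      (Finset.powerset ({i, j} : Finset ι)ᶜ).card := by
    refine Finset.card_nbij' (fun I => I.erase i) (fun I => insert i I) ?_ ?_ ?_ ?_
    · intro I hI
      simp only [Finset.coe_filter, Finset.mem_univ, true_and, Set.mem_ofPred_eq] at hI
      simp only [Finset.coe_powerset, Set.mem_preimage, Set.mem_powerset_iff]
      intro x hx
      simp only [Finset.coe_erase, Set.mem_sdiff, Finset.mem_coe, Set.mem_singleton_iff] at hx
      simp only [Finset.coe_compl, Set.mem_compl_iff, Finset.mem_coe, Finset.mem_insert,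
        Finset.mem_singleton]
      rintro (rfl | rfl)
      · exact hx.2 rfl
      · exact hI.2 hx.1
    · intro I hI
      have hI' : I ⊆ ({i, j} : Finset ι)ᶜ := Finset.mem_powerset.1 (Finset.mem_coe.1 hI)
      have hj : j ∉ I := fun hj => by have := hI' hj; simp at this
      simp [hj, hij.symm]
    · intro I hI
      simp only [Finset.coe_filter, Finset.mem_univ, true_and, Set.mem_ofPred_eq] at hI
      exact Finset.insert_erase hI.1
    · intro I hI
      have hI' : I ⊆ ({i, j} : Finset ι)ᶜ := Finset.mem_powerset.1 (Finset.mem_coe.1 hI)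
      have hi : i ∉ I := fun hi => by have := hI' hi; simp at this
      exact Finset.erase_insert hi
  have h2 : 2 ≤ Fintype.card ι := by
    rw [← Finset.card_pair hij]
    exact Finset.card_le_univ _
  rw [h1, Finset.card_powerset, Finset.card_compl, Finset.card_pair hij]
  obtain ⟨m, hm⟩ := Nat.exists_eq_add_of_le h2
  rw [hm, pow_add]
  simp

/-- The average over all index sets of the bipartite parts of a double sum is a quarter of its
off-diagonal part. -/
theorem four_mul_sum_bipartite (f : ι → ι → ℝ) :
    4 * ∑ I : Finset ι, ∑ i ∈ I, ∑ j ∈ Iᶜ, f i j =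
      2 ^ Fintype.card ι * ∑ i, ∑ j ∈ Finset.univ.erase i, f i j := by
  have h1 : ∀ I : Finset ι, ∑ i ∈ I, ∑ j ∈ Iᶜ, f i j =
      ∑ i, ∑ j, if i ∈ I ∧ j ∉ I then f i j else 0 := by
    intro I
    rw [← Finset.sum_subset (Finset.subset_univ I)]
    · refine Finset.sum_congr rfl fun i hi => ?_
      rw [← Finset.sum_subset (Finset.subset_univ Iᶜ)]
      · refine Finset.sum_congr rfl fun j hj => ?_
        rw [if_pos ⟨hi, Finset.mem_compl.1 hj⟩]
      · intro j _ hj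
        rw [if_neg (fun h => hj (Finset.mem_compl.2 h.2))]
    · intro i _ hi
      exact Finset.sum_eq_zero fun j _ => if_neg fun h => hi h.1
  simp_rw [h1]
  rw [Finset.sum_comm, Finset.mul_sum, Finset.mul_sum]
  refine Finset.sum_congr rfl fun i _ => ?_
  rw [Finset.sum_comm, Finset.mul_sum, Finset.mul_sum,
    ← Finset.sum_erase (a := i) Finset.univ]
  · refine Finset.sum_congr rfl fun j hj => ?_
    rw [← Finset.sum_filter, Finset.sum_const, nsmul_eq_mul, ← mul_assoc]
    congr 1
    exact_mod_cast four_mul_card_separating (Finset.ne_of_mem_erase hj).symm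
  · simp

/-- Decoupling: an exponential moment of the off-diagonal part of a double sum is bounded by the
ones of its bipartite parts. -/
theorem lintegral_exp_offDiag_le (f : (ι → ℝ) → ι → ι → ℝ)
    (hf : ∀ i j, Measurable fun x => f x i j) (l : ℝ) (c : ENNReal)
    (h : ∀ I : Finset ι, ∫⁻ x, ENNReal.ofReal
      (Real.exp (4 * l * ∑ i ∈ I, ∑ j ∈ Iᶜ, f x i j)) ∂Measure.pi ν ≤ c) :
    ∫⁻ x, ENNReal.ofReal (Real.exp (l * ∑ i, ∑ j ∈ Finset.univ.erase i, f x i j))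
      ∂Measure.pi ν ≤ c := by
  set N : ℝ := 2 ^ Fintype.card ι with hN
  have hN0 : 0 < N := by positivity
  have hcard : (Fintype.card (Finset ι) : ℝ) = N := by simp [hN]
  have hpt : ∀ x, Real.exp (l * ∑ i, ∑ j ∈ Finset.univ.erase i, f x i j) ≤
      ∑ I : Finset ι, N⁻¹ * Real.exp (4 * l * ∑ i ∈ I, ∑ j ∈ Iᶜ, f x i j) := by
    intro x
    -- Jensen for the uniform distribution on index sets; the factor `4` undoes the separation
    -- probability.
    have hJ := convexOn_exp.map_sum_le (t := Finset.univ) (w := fun _ : Finset ι => N⁻¹)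
      (p := fun I : Finset ι => 4 * l * ∑ i ∈ I, ∑ j ∈ Iᶜ, f x i j)
      (fun _ _ => by positivity) (by rw [Finset.sum_const, nsmul_eq_mul, Finset.card_univ, hcard, mul_inv_cancel₀ hN0.ne']) (fun _ _ => Set.mem_univ _)
    simp only [smul_eq_mul] at hJ
    refine le_trans (le_of_eq ?_) hJ
    congr 1
    rw [← Finset.mul_sum, ← Finset.mul_sum, mul_comm (4 : ℝ) l, mul_assoc,
      four_mul_sum_bipartite, ← hN]
    field_simp
  calc _ ≤ ∫⁻ x, ∑ I : Finset ι, ENNReal.ofReal N⁻¹ * ENNReal.ofReal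
          (Real.exp (4 * l * ∑ i ∈ I, ∑ j ∈ Iᶜ, f x i j)) ∂Measure.pi ν := by
        refine lintegral_mono fun x => (ENNReal.ofReal_le_ofReal (hpt x)).trans ?_
        rw [ENNReal.ofReal_sum_of_nonneg fun _ _ => by positivity]
        exact Finset.sum_le_sum fun I _ => (ENNReal.ofReal_mul (by positivity)).le
    _ = ∑ I : Finset ι, ENNReal.ofReal N⁻¹ * ∫⁻ x, ENNReal.ofReal
          (Real.exp (4 * l * ∑ i ∈ I, ∑ j ∈ Iᶜ, f x i j)) ∂Measure.pi ν := by
        rw [lintegral_finsetSum _ fun I _ => by fun_prop]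
        exact Finset.sum_congr rfl fun I _ => lintegral_const_mul _ (by fun_prop)
    _ ≤ ∑ I : Finset ι, ENNReal.ofReal N⁻¹ * c := by
        gcongr with I _
        exact h I
    _ = c := by
        rw [Finset.sum_const, nsmul_eq_mul, ← mul_assoc, Finset.card_univ,
          ← ENNReal.ofReal_natCast, hcard, ← ENNReal.ofReal_mul hN0.le, mul_inv_cancel₀ hN0.ne']
        simp

variable {κ : Type*} [Fintype κ] (X : Matrix κ ι ℝ)

theorem mulVec_dotProduct_mulVec_eq_sum {κ ι : Type*} [Fintype κ] [Fintype ι] (X : Matrix κ ι ℝ)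
    (a b : ι → ℝ) :
    (X *ᵥ a) ⬝ᵥ (X *ᵥ b) = ∑ i, ∑ j, (Xᵀ * X) i j * (a i * b j) := by
  rw [dotProduct_mulVec, vecMul_mulVec, ← dotProduct_mulVec]
  simp only [dotProduct, mulVec, Finset.mul_sum]
  exact Finset.sum_congr rfl fun i _ => Finset.sum_congr rfl fun j _ => by ring

theorem dotProduct_mulVec_piecewise_eq (I : Finset ι) (x : ι → ℝ) :
    (X *ᵥ I.piecewise x 0) ⬝ᵥ (X *ᵥ I.piecewise 0 x) =
      ∑ i ∈ I, ∑ j ∈ Iᶜ, (Xᵀ * X) i j * (x i * x j) := by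
  rw [mulVec_dotProduct_mulVec_eq_sum, ← Finset.sum_subset (Finset.subset_univ I)]
  · refine Finset.sum_congr rfl fun i hi => ?_
    rw [← Finset.sum_subset (Finset.subset_univ Iᶜ)]
    · refine Finset.sum_congr rfl fun j hj => ?_
      rw [Finset.piecewise_eq_of_mem _ _ _ hi,
        Finset.piecewise_eq_of_notMem _ _ _ (Finset.mem_compl.1 hj)]
    · intro j _ hj
      rw [Finset.mem_compl, not_not] at hj
      simp [hj]
  · intro i _ hi
    simp [hi]

/-- The exponential moment of a bipartite part of a quadratic form is bounded by the one of the form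
itself. -/
theorem lintegral_exp_bipartite_le {L M σ : ℝ} (hM : 0 < M) (hL : 0 ≤ L) (hσ : 0 ≤ σ)
    (h : ∀ i, IsSubgaussianLaw (ν i) L M)
    (hX : ∀ u : κ → ℝ, (u ᵥ* X) ⬝ᵥ (u ᵥ* X) ≤ σ * (u ⬝ᵥ u)) (I : Finset ι) (l : ℝ) :
    ∫⁻ x, ENNReal.ofReal (Real.exp (l * ((X *ᵥ I.piecewise x 0) ⬝ᵥ (X *ᵥ I.piecewise 0 x))))
      ∂Measure.pi ν ≤
    ∫⁻ x, ENNReal.ofReal (Real.exp (L * σ * l ^ 2 * ((X *ᵥ x) ⬝ᵥ (X *ᵥ x)))) ∂Measure.pi ν := by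
  have hc0 : Continuous fun x : ι → ℝ => I.piecewise x 0 := by
    refine continuous_pi fun i => ?_
    by_cases hi : i ∈ I <;> simp only [Finset.piecewise, hi, if_true, if_false] <;> fun_prop
  have hc1 : Continuous fun x : ι → ℝ => I.piecewise (0 : ι → ℝ) x := by
    refine continuous_pi fun i => ?_
    by_cases hi : i ∈ I <;> simp only [Finset.piecewise, hi, if_true, if_false] <;> fun_prop
  have hXc : Continuous fun x : ι → ℝ => X *ᵥ x := continuous_const.matrix_mulVec continuous_id
  have hp := measurePreserving_piecewise ν I
  have hm1 : Measurable fun x : ι → ℝ => ENNReal.ofReal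
      (Real.exp (l * ((X *ᵥ I.piecewise x 0) ⬝ᵥ (X *ᵥ I.piecewise 0 x)))) :=
    (Continuous.measurable (Real.continuous_exp.comp (continuous_const.mul
      ((hXc.comp hc0).dotProduct (hXc.comp hc1))))).ennreal_ofReal
  have hm2 : Measurable fun x : ι → ℝ => ENNReal.ofReal
      (Real.exp (L * σ * l ^ 2 * ((X *ᵥ x) ⬝ᵥ (X *ᵥ x)))) :=
    (Continuous.measurable (Real.continuous_exp.comp (continuous_const.mul
      (hXc.dotProduct hXc)))).ennreal_ofReal
  have split : ∀ x y : ι → ℝ, I.piecewise x y = I.piecewise x 0 + I.piecewise (0 : ι → ℝ) y := by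
    intro x y
    ext i
    by_cases hi : i ∈ I <;> simp [hi]
  have e0 : ∀ x y : ι → ℝ, I.piecewise (I.piecewise x y) 0 = I.piecewise x 0 := by
    intro x y
    ext i
    by_cases hi : i ∈ I <;> simp [hi]
  have e1 : ∀ x y : ι → ℝ, I.piecewise (0 : ι → ℝ) (I.piecewise x y) =
      I.piecewise (0 : ι → ℝ) y := by
    intro x y
    ext i
    by_cases hi : i ∈ I <;> simp [hi]
  -- With the coordinates in `I` frozen, the bipartite form is linear in the others; `w x` is its
  -- coefficient vector, the part of `Xᵀ X x_I` outside `I`.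
  set w : (ι → ℝ) → ι → ℝ := fun x => I.piecewise 0 ((X *ᵥ I.piecewise x 0) ᵥ* X) with hw
  have hwd : ∀ x y : ι → ℝ, (X *ᵥ I.piecewise x 0) ⬝ᵥ (X *ᵥ I.piecewise 0 y) = w x ⬝ᵥ y := by
    intro x y
    rw [dotProduct_mulVec]
    refine Finset.sum_congr rfl fun i _ => ?_
    by_cases hi : i ∈ I <;> simp [hw, hi]
  have hww : ∀ x, w x ⬝ᵥ w x ≤ σ * ((X *ᵥ I.piecewise x 0) ⬝ᵥ (X *ᵥ I.piecewise x 0)) := by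
    intro x
    refine le_trans (Finset.sum_le_sum fun i _ => ?_) (hX _)
    by_cases hi : i ∈ I <;> simp [hw, hi, mul_self_nonneg]
  have hm1' := hm1.comp hp.measurable
  have hm2' := hm2.comp hp.measurable
  simp only [Function.comp_def] at hm1' hm2'
  rw [← hp.lintegral_comp hm1, ← hp.lintegral_comp hm2,
    lintegral_prod _ hm1'.aemeasurable, lintegral_prod _ hm2'.aemeasurable]
  refine lintegral_mono fun x => ?_
  simp only [e0, e1, hwd]
  set q := (X *ᵥ I.piecewise x 0) ⬝ᵥ (X *ᵥ I.piecewise x 0) with hq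
  set s := L * σ * l ^ 2 with hs
  have hs0 : 0 ≤ s := by positivity
  calc ∫⁻ y, ENNReal.ofReal (Real.exp (l * (w x ⬝ᵥ y))) ∂Measure.pi ν
      ≤ ENNReal.ofReal (Real.exp (L * ((l • w x) ⬝ᵥ (l • w x)))) := by
        simpa only [smul_dotProduct, smul_eq_mul] using lintegral_exp_dotProduct_le h (l • w x)
    _ ≤ ENNReal.ofReal (Real.exp (s * q)) := by
        apply ENNReal.ofReal_le_ofReal
        apply Real.exp_le_exp.2
        rw [smul_dotProduct, dotProduct_smul, smul_eq_mul, smul_eq_mul, hs]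
        calc L * (l * (l * (w x ⬝ᵥ w x))) = L * l ^ 2 * (w x ⬝ᵥ w x) := by ring
          _ ≤ L * l ^ 2 * (σ * q) := by gcongr; exact hww x
          _ = _ := by ring
    -- The new factor is at least one by Jensen. Its coefficient `2 * s` makes it the cross term in
    -- the expansion of `s ‖X (x_I + y_{Iᶜ})‖²`, and the missing square in `y` is nonnegative.
    _ ≤ ENNReal.ofReal (Real.exp (s * q)) *
          ∫⁻ y, ENNReal.ofReal (Real.exp (((2 * s) • w x) ⬝ᵥ y)) ∂Measure.pi ν :=
        le_mul_of_one_le_right' (one_le_lintegral_exp_dotProduct hM h _)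
    _ = ∫⁻ y, ENNReal.ofReal (Real.exp (s * q)) *
          ENNReal.ofReal (Real.exp (((2 * s) • w x) ⬝ᵥ y)) ∂Measure.pi ν := by
        rw [lintegral_const_mul']
        exact ENNReal.ofReal_ne_top
    _ ≤ _ := by
        refine lintegral_mono fun y => ?_
        dsimp only
        rw [← ENNReal.ofReal_mul (Real.exp_pos _).le, ← Real.exp_add]
        apply ENNReal.ofReal_le_ofReal
        apply Real.exp_le_exp.2
        rw [split x y, mulVec_add, dotProduct_add, add_dotProduct, add_dotProduct,
          dotProduct_comm (X *ᵥ I.piecewise 0 y) (X *ᵥ I.piecewise x 0), hwd, ← hq,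
          smul_dotProduct, smul_eq_mul]
        have h0 : 0 ≤ (X *ᵥ I.piecewise 0 y) ⬝ᵥ (X *ᵥ I.piecewise 0 y) :=
          Finset.sum_nonneg fun i _ => mul_self_nonneg _
        nlinarith [mul_nonneg hs0 h0]

end Pi

/-! ### Hanson–Wright inequality for positive semidefinite forms -/

section HansonWright

variable {ι κ : Type*} [Fintype ι] [DecidableEq ι] [Fintype κ] {ν : ι → Measure ℝ}
  [∀ i, IsProbabilityMeasure (ν i)] {L M σ : ℝ} (X : Matrix κ ι ℝ)

theorem lintegral_exp_diag_le (hM : 1 ≤ M) (h : ∀ i, IsSubgaussianLaw (ν i) L M) (s : ι → ℝ)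
    (hs : ∀ i, |s i| ≤ 1 / (2 * M)) :
    ∫⁻ x, ENNReal.ofReal (Real.exp (∑ i, s i * (x i ^ 2 - 1))) ∂Measure.pi ν ≤
      ENNReal.ofReal (Real.exp (48 * M ^ 2 * ∑ i, s i ^ 2)) := by
  have hB := fun i => integral_exp_mul_sq_sub_one_le hM aemeasurable_id (h i).integrable_exp_sq
    (h i).integral_exp_sq_le (h i).integral_sq (hs i)
  simp only [id] at hB
  simp only [Real.exp_sum, Finset.mul_sum]
  rw [← ofReal_integral_eq_lintegral_ofReal]
  · rw [integral_fintype_prod_eq_prod (fun i x => Real.exp (s i * (x ^ 2 - 1)))]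
    exact ENNReal.ofReal_le_ofReal (Finset.prod_le_prod
      (fun i _ => integral_nonneg fun x => (Real.exp_pos _).le) fun i _ => (hB i).2)
  · exact Integrable.fintype_prod_dep (f := fun i x => Real.exp (s i * (x ^ 2 - 1)))
      fun i => (hB i).1
  · exact ae_of_all _ fun y => Finset.prod_nonneg fun i _ => (Real.exp_pos _).le

theorem mulVec_dotProduct_self_sub_trace (x : ι → ℝ) :
    (X *ᵥ x) ⬝ᵥ (X *ᵥ x) - (Xᵀ * X).trace = ∑ i, (Xᵀ * X) i i * (x i ^ 2 - 1) +
      ∑ i, ∑ j ∈ Finset.univ.erase i, (Xᵀ * X) i j * (x i * x j) := by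
  rw [mulVec_dotProduct_mulVec_eq_sum, trace, ← Finset.sum_sub_distrib, ← Finset.sum_add_distrib]
  refine Finset.sum_congr rfl fun i _ => ?_
  rw [← Finset.add_sum_erase _ _ (Finset.mem_univ i), diag_apply]
  ring

theorem continuous_mulVec_dotProduct_self : Continuous fun x : ι → ℝ => (X *ᵥ x) ⬝ᵥ (X *ᵥ x) :=
  (continuous_const.matrix_mulVec continuous_id).dotProduct
    (continuous_const.matrix_mulVec continuous_id)

variable {X}

/-- In this range of `l` the form is dominated by `∑ x i ^ 2 / M`, whose exponential is a product of
integrable factors. Finiteness is what makes the later self-bounding division legitimate. -/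
theorem integrable_exp_quadForm (hM : 0 < M) (hσ : 0 < σ)
    (h : ∀ i, IsSubgaussianLaw (ν i) L M)
    (hX : ∀ z : ι → ℝ, (X *ᵥ z) ⬝ᵥ (X *ᵥ z) ≤ σ * (z ⬝ᵥ z)) {l : ℝ} (hl : |l| ≤ 1 / (4 * M * σ)) :
    Integrable (fun x => Real.exp (l * ((X *ᵥ x) ⬝ᵥ (X *ᵥ x) - (Xᵀ * X).trace)))
      (Measure.pi ν) := by
  have hb : Integrable (fun x : ι → ℝ => ∏ i, Real.exp (x i ^ 2 / M)) (Measure.pi ν) :=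
    Integrable.fintype_prod_dep (f := fun i x => Real.exp (x ^ 2 / M))
      fun i => (h i).integrable_exp_sq
  refine (hb.const_mul (Real.exp (-l * (Xᵀ * X).trace))).mono' ?_ (ae_of_all _ fun x => ?_)
  · exact (Real.continuous_exp.comp (continuous_const.mul
      ((continuous_mulVec_dotProduct_self X).sub continuous_const))).aestronglyMeasurable
  · rw [Real.norm_of_nonneg (Real.exp_pos _).le, ← Real.exp_sum, ← Real.exp_add]
    apply Real.exp_le_exp.2
    have hQ : 0 ≤ (X *ᵥ x) ⬝ᵥ (X *ᵥ x) := Finset.sum_nonneg fun i _ => mul_self_nonneg _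
    have hx : 0 ≤ x ⬝ᵥ x := Finset.sum_nonneg fun i _ => mul_self_nonneg _
    have e : ∑ i, x i ^ 2 / M = (x ⬝ᵥ x) / M := by
      rw [dotProduct, Finset.sum_div]
      exact Finset.sum_congr rfl fun i _ => by ring
    have h1 : l * ((X *ᵥ x) ⬝ᵥ (X *ᵥ x)) ≤ (x ⬝ᵥ x) / M := by
      calc _ ≤ |l| * ((X *ᵥ x) ⬝ᵥ (X *ᵥ x)) := by gcongr; exact le_abs_self l
        _ ≤ 1 / (4 * M * σ) * (σ * (x ⬝ᵥ x)) := by gcongr; exact hX x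
        _ = (x ⬝ᵥ x) / M / 4 := by field_simp
        _ ≤ (x ⬝ᵥ x) / M := by
          have : 0 ≤ (x ⬝ᵥ x) / M := by positivity
          linarith
    rw [e]
    linarith

theorem sq_lintegral_exp_add_le {α : Type*} [MeasurableSpace α] {μ : Measure α} {f g : α → ℝ}
    (hf : Measurable f) (hg : Measurable g) :
    (∫⁻ x, ENNReal.ofReal (Real.exp (f x + g x)) ∂μ) ^ 2 ≤
      (∫⁻ x, ENNReal.ofReal (Real.exp (2 * f x)) ∂μ) *
        ∫⁻ x, ENNReal.ofReal (Real.exp (2 * g x)) ∂μ := by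
  have hCS := ENNReal.lintegral_mul_le_Lp_mul_Lq μ Real.HolderConjugate.two_two
    (f := fun x => ENNReal.ofReal (Real.exp (f x))) (g := fun x => ENNReal.ofReal (Real.exp (g x)))
    (by fun_prop) (by fun_prop)
  have e : ∀ y : ℝ, ENNReal.ofReal (Real.exp y) ^ (2 : ℝ) = ENNReal.ofReal (Real.exp (2 * y)) := by
    intro y
    rw [ENNReal.ofReal_rpow_of_pos (Real.exp_pos _), ← Real.exp_mul, mul_comm]
  simp only [e, Pi.mul_apply, ← ENNReal.ofReal_mul (Real.exp_pos _).le, ← Real.exp_add] at hCS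
  refine (pow_le_pow_left' hCS 2).trans (le_of_eq ?_)
  rw [mul_pow, ← ENNReal.rpow_two, ← ENNReal.rpow_two, ← ENNReal.rpow_mul, ← ENNReal.rpow_mul]
  norm_num

theorem diag_transpose_mul_self_nonneg (X : Matrix κ ι ℝ) (i : ι) : 0 ≤ (Xᵀ * X) i i := by
  rw [mul_apply]
  exact Finset.sum_nonneg fun r _ => mul_self_nonneg _

theorem diag_transpose_mul_self_le
    (hX : ∀ z : ι → ℝ, (X *ᵥ z) ⬝ᵥ (X *ᵥ z) ≤ σ * (z ⬝ᵥ z)) (i : ι) : (Xᵀ * X) i i ≤ σ := by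
  have := hX (Pi.single i 1)
  simp only [mulVec_single_one, single_dotProduct, Pi.single_eq_same, mul_one] at this
  exact this

/-- The left side is the convexity weight of the self-bounding step; the constants give `64 / (24 *
4) = 2/3`. -/
theorem le_of_mul_div_four {a M σ L : ℝ} (hM : 0 < M) (hσ : 0 < σ) (ha : 0 ≤ a)
    (h : a ≤ 1 / (4 * M * σ)) (hLM : 24 * L ≤ M) : 64 * L * σ * a ≤ 1 := by
  rw [le_div_iff₀ (by positivity)] at h
  have : 0 ≤ a * σ := by positivity
  nlinarith

/-- A self-bounding inequality for the exponential moments of a centred quadratic form. -/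
theorem sq_integral_exp_quadForm_le (hM : 1 ≤ M) (hL : 0 ≤ L) (hLM : 24 * L ≤ M) (hσ : 0 < σ)
    (h : ∀ i, IsSubgaussianLaw (ν i) L M)
    (hX : ∀ z : ι → ℝ, (X *ᵥ z) ⬝ᵥ (X *ᵥ z) ≤ σ * (z ⬝ᵥ z))
    (hX' : ∀ u : κ → ℝ, (u ᵥ* X) ⬝ᵥ (u ᵥ* X) ≤ σ * (u ⬝ᵥ u)) {l : ℝ}
    (hl : |l| ≤ 1 / (4 * M * σ)) :
    (∫ x, Real.exp (l * ((X *ᵥ x) ⬝ᵥ (X *ᵥ x) - (Xᵀ * X).trace)) ∂Measure.pi ν) ^ 2 ≤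
      Real.exp (192 * M ^ 2 * l ^ 2 * ∑ i, (Xᵀ * X) i i ^ 2) *
        ∫ x, Real.exp (64 * L * σ * l ^ 2 * ((X *ᵥ x) ⬝ᵥ (X *ᵥ x))) ∂Measure.pi ν := by
  have hM0 : 0 < M := by linarith
  set s := 64 * L * σ * l ^ 2 with hs
  have hsl : s ≤ |l| := by
    have := le_of_mul_div_four hM0 hσ (abs_nonneg l) hl hLM
    rw [hs, ← sq_abs]
    nlinarith [abs_nonneg l]
  have hs0 : 0 ≤ s := by positivity
  have hi := integrable_exp_quadForm hM0 hσ h hX hl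
  have his := integrable_exp_quadForm hM0 hσ h hX (l := s)
    ((abs_of_nonneg hs0).trans_le (hsl.trans hl))
  have hiQ : Integrable (fun x => Real.exp (s * ((X *ᵥ x) ⬝ᵥ (X *ᵥ x)))) (Measure.pi ν) := by
    convert his.const_mul (Real.exp (s * (Xᵀ * X).trace)) using 2 with x
    rw [← Real.exp_add]
    ring_nf
  -- The `2` comes from Cauchy–Schwarz; the range of `l` is chosen so that these coefficients meet
  -- the Bernstein condition.
  have hD := lintegral_exp_diag_le hM h (fun i => 2 * l * (Xᵀ * X) i i) (fun i => by
    rw [abs_mul, abs_mul, abs_two, abs_of_nonneg (diag_transpose_mul_self_nonneg X i)]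
    have h0 := diag_transpose_mul_self_nonneg X i
    calc 2 * |l| * (Xᵀ * X) i i ≤ 2 * (1 / (4 * M * σ)) * σ := by
          gcongr
          exact diag_transpose_mul_self_le hX i
      _ = 1 / (2 * M) := by field_simp; norm_num)
  -- The factor `2` of Cauchy–Schwarz and the factor `4` of decoupling give `8 * l`, whence `64`
  -- after squaring.
  have hO := lintegral_exp_offDiag_le (ν := ν) (fun x i j => (Xᵀ * X) i j * (x i * x j))
    (fun i j => by fun_prop) (2 * l)
    (∫⁻ x, ENNReal.ofReal (Real.exp (s * ((X *ᵥ x) ⬝ᵥ (X *ᵥ x)))) ∂Measure.pi ν) (fun I => by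
      simp only [← dotProduct_mulVec_piecewise_eq]
      convert lintegral_exp_bipartite_le X hM0 hL hσ.le h hX' I (4 * (2 * l)) using 5
      rw [hs]
      ring)
  have hCS := sq_lintegral_exp_add_le (μ := Measure.pi ν)
    (f := fun x => l * ∑ i, (Xᵀ * X) i i * (x i ^ 2 - 1))
    (g := fun x => l * ∑ i, ∑ j ∈ Finset.univ.erase i, (Xᵀ * X) i j * (x i * x j))
    (by fun_prop) (by fun_prop)
  have eD : ∀ x : ι → ℝ, 2 * (l * ∑ i, (Xᵀ * X) i i * (x i ^ 2 - 1)) =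
      ∑ i, 2 * l * (Xᵀ * X) i i * (x i ^ 2 - 1) := by
    intro x
    rw [← mul_assoc, Finset.mul_sum]
    exact Finset.sum_congr rfl fun i _ => by ring
  have eS : 48 * M ^ 2 * ∑ i, (2 * l * (Xᵀ * X) i i) ^ 2 =
      192 * M ^ 2 * l ^ 2 * ∑ i, (Xᵀ * X) i i ^ 2 := by
    rw [Finset.mul_sum, Finset.mul_sum]
    exact Finset.sum_congr rfl fun i _ => by ring
  simp only [← mul_add, ← mulVec_dotProduct_self_sub_trace, eD] at hCS
  simp only [← mul_assoc (2 : ℝ) l] at hCS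
  rw [eS] at hD
  have hfin := hCS.trans (mul_le_mul' hD hO)
  rw [← ofReal_integral_eq_lintegral_ofReal hi (ae_of_all _ fun x => (Real.exp_pos _).le),
    ← ofReal_integral_eq_lintegral_ofReal hiQ (ae_of_all _ fun x => (Real.exp_pos _).le),
    ← ENNReal.ofReal_pow (integral_nonneg fun x => (Real.exp_pos _).le),
    ← ENNReal.ofReal_mul (Real.exp_pos _).le, ENNReal.ofReal_le_ofReal_iff (mul_nonneg
      (Real.exp_pos _).le (integral_nonneg fun x => (Real.exp_pos _).le))] at hfin
  exact hfin

/-- The **Hanson–Wright inequality** for positive semidefinite quadratic forms, as a bound on the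
moment generating function. -/
theorem integral_exp_quadForm_le (hM : 1 ≤ M) (hL : 0 ≤ L) (hLM : 24 * L ≤ M) (hσ : 0 < σ)
    (h : ∀ i, IsSubgaussianLaw (ν i) L M)
    (hX : ∀ z : ι → ℝ, (X *ᵥ z) ⬝ᵥ (X *ᵥ z) ≤ σ * (z ⬝ᵥ z))
    (hX' : ∀ u : κ → ℝ, (u ᵥ* X) ⬝ᵥ (u ᵥ* X) ≤ σ * (u ⬝ᵥ u)) {l : ℝ}
    (hl : |l| ≤ 1 / (4 * M * σ)) :
    ∫ x, Real.exp (l * ((X *ᵥ x) ⬝ᵥ (X *ᵥ x) - (Xᵀ * X).trace)) ∂Measure.pi ν ≤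
      Real.exp (256 * M ^ 2 * σ * (Xᵀ * X).trace * l ^ 2) := by
  have hM0 : 0 < M := by linarith
  set τ := (Xᵀ * X).trace with hτ
  set F : ℝ → ℝ := fun l => ∫ x, Real.exp (l * ((X *ᵥ x) ⬝ᵥ (X *ᵥ x) - τ)) ∂Measure.pi ν with hF
  set β := 256 * M ^ 2 * σ * τ * l ^ 2 with hβ
  have hF0 : ∀ l, 0 ≤ F l := fun l => integral_nonneg fun x => (Real.exp_pos _).le
  have hτ0 : 0 ≤ τ := Finset.sum_nonneg fun i _ => diag_transpose_mul_self_nonneg X i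
  have hβ1 : 1 ≤ Real.exp β := Real.one_le_exp (by positivity)
  -- The off-diagonal coefficient is `r = θ |l|` with `θ = 64 L σ |l| ≤ 1`, so convexity compares
  -- its exponential moment with `F |l|`. It depends on `l²` only, so both signs of `s` lead to the
  -- same right-hand side.
  have hself : ∀ s : ℝ, |s| = |l| → F s ^ 2 ≤ Real.exp β * max 1 (F |l|) := by
    intro s hsl
    have hsq := sq_integral_exp_quadForm_le hM hL hLM hσ h hX hX' (l := s) (hsl.trans_le hl)
    have hsl2 : s ^ 2 = l ^ 2 := by rw [← sq_abs, hsl, sq_abs]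
    rw [hsl2] at hsq
    refine hsq.trans ?_
    set r := 64 * L * σ * l ^ 2 with hr
    have hr0 : 0 ≤ r := by positivity
    have hθ := le_of_mul_div_four hM0 hσ (abs_nonneg l) hl hLM
    have hil := integrable_exp_quadForm hM0 hσ h hX (l := |l|) ((abs_abs l).trans_le hl)
    have hQ : ∫ x, Real.exp (r * ((X *ᵥ x) ⬝ᵥ (X *ᵥ x))) ∂Measure.pi ν ≤
        Real.exp (r * τ) * max 1 (F |l|) := by
      have hθ0 : 0 ≤ 64 * L * σ * |l| := by positivity
      have hb := ((integrable_const (1 - 64 * L * σ * |l|)).add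
        (hil.const_mul (64 * L * σ * |l|))).const_mul (Real.exp (r * τ))
      have hpt : ∀ x, Real.exp (r * ((X *ᵥ x) ⬝ᵥ (X *ᵥ x))) ≤
          Real.exp (r * τ) * (1 - 64 * L * σ * |l| +
            64 * L * σ * |l| * Real.exp (|l| * ((X *ᵥ x) ⬝ᵥ (X *ᵥ x) - τ))) := by
        intro x
        have := exp_mul_le_one_sub_add hθ0 hθ (|l| * ((X *ᵥ x) ⬝ᵥ (X *ᵥ x) - τ))
        refine le_trans (le_of_eq ?_) (mul_le_mul_of_nonneg_left this (Real.exp_pos (r * τ)).le)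
        rw [← Real.exp_add, hr, ← sq_abs l]
        ring_nf
      refine (integral_mono_of_nonneg (ae_of_all _ fun x => (Real.exp_pos _).le) hb
        (ae_of_all _ hpt)).trans ?_
      simp only [Pi.add_apply]
      rw [integral_const_mul, integral_add (integrable_const _) (hil.const_mul _),
        integral_const_mul]
      simp only [integral_const, probReal_univ, smul_eq_mul, one_mul]
      gcongr
      change 1 - 64 * L * σ * |l| + 64 * L * σ * |l| * F |l| ≤ _
      nlinarith [le_max_left 1 (F |l|), le_max_right 1 (F |l|)]
    calc _ ≤ Real.exp (192 * M ^ 2 * l ^ 2 * ∑ i, (Xᵀ * X) i i ^ 2) *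
          (Real.exp (r * τ) * max 1 (F |l|)) := by gcongr
      _ = Real.exp (192 * M ^ 2 * l ^ 2 * ∑ i, (Xᵀ * X) i i ^ 2 + r * τ) * max 1 (F |l|) := by
          rw [← mul_assoc, ← Real.exp_add]
      _ ≤ _ := by
          gcongr
          have hsum : ∑ i, (Xᵀ * X) i i ^ 2 ≤ σ * τ := by
            rw [hτ, trace, Finset.mul_sum]
            refine Finset.sum_le_sum fun i _ => ?_
            rw [pow_two, diag_apply]
            exact mul_le_mul_of_nonneg_right (diag_transpose_mul_self_le hX i)
              (diag_transpose_mul_self_nonneg X i)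
          have hLM2 : L ≤ M ^ 2 := by nlinarith
          calc _ ≤ 192 * M ^ 2 * l ^ 2 * (σ * τ) + 64 * M ^ 2 * σ * l ^ 2 * τ := by
                rw [hr]; gcongr
            _ = β := by rw [hβ]; ring
  -- At `s = |l|` the same quantity stands on both sides and one factor cancels; the bound for `l`
  -- itself then follows.
  have habs : F |l| ≤ Real.exp β := by
    have := hself |l| (abs_abs l)
    rcases le_total (F |l|) 1 with h1 | h1
    · exact h1.trans hβ1
    · rw [max_eq_right h1, pow_two] at this
      exact le_of_mul_le_mul_right this (by linarith)
  have hl2 := hself l rfl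
  have hmax : max 1 (F |l|) ≤ Real.exp β := max_le hβ1 habs
  change F l ≤ _
  refine (sq_le_sq₀ (hF0 l) (Real.exp_pos _).le).1 ?_
  calc _ ≤ _ := hl2
    _ ≤ Real.exp β * Real.exp β := by gcongr
    _ = _ := by ring

/-- The **Hanson–Wright inequality** for positive semidefinite quadratic forms. -/
theorem measure_quadForm_deviation_le (hM : 1 ≤ M) (hL : 0 ≤ L) (hLM : 24 * L ≤ M) (hσ : 0 < σ)
    (h : ∀ i, IsSubgaussianLaw (ν i) L M)
    (hX : ∀ z : ι → ℝ, (X *ᵥ z) ⬝ᵥ (X *ᵥ z) ≤ σ * (z ⬝ᵥ z))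
    (hX' : ∀ u : κ → ℝ, (u ᵥ* X) ⬝ᵥ (u ᵥ* X) ≤ σ * (u ⬝ᵥ u)) {δ : ℝ} (hδ : 0 ≤ δ) (hδ1 : δ ≤ 1) :
    (Measure.pi ν).real {x | δ * (Xᵀ * X).trace ≤ |(X *ᵥ x) ⬝ᵥ (X *ᵥ x) - (Xᵀ * X).trace|} ≤
      2 * Real.exp (-(δ ^ 2 * (Xᵀ * X).trace / (1024 * M ^ 2 * σ))) := by
  have hM0 : 0 < M := by linarith
  set τ := (Xᵀ * X).trace with hτ
  set Z : (ι → ℝ) → ℝ := fun x => (X *ᵥ x) ⬝ᵥ (X *ᵥ x) - τ with hZ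
  -- The minimiser of the Chernoff exponent `-l δ τ + 256 M² σ τ l²`.
  set l : ℝ := δ / (512 * M ^ 2 * σ) with hl
  have hl0 : 0 ≤ l := by positivity
  have hl1 : l ≤ 1 / (4 * M * σ) := by
    rw [hl, div_le_div_iff₀ (by positivity) (by positivity), one_mul]
    calc δ * (4 * M * σ) ≤ 1 * (4 * M * σ) := by gcongr
      _ ≤ M * (512 * M * σ) := by
        have : 0 < M * σ := by positivity
        nlinarith
      _ = _ := by ring
  have hb : ∀ s : ℝ, |s| = l → (Measure.pi ν).real {x | δ * τ ≤ s / l * Z x} ≤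
      Real.exp (-(δ ^ 2 * τ / (1024 * M ^ 2 * σ))) ∨ l = 0 := by
    intro s hs
    rcases eq_or_lt_of_le hl0 with h0 | h0
    · exact Or.inr h0.symm
    left
    have hs1 : |s| ≤ 1 / (4 * M * σ) := hs ▸ hl1
    have hi := integrable_exp_quadForm hM0 hσ h hX hs1
    have e : ∀ x, l * (s / l * Z x) = s * Z x := fun x => by field_simp
    have := measure_ge_le_exp_mul_mgf (μ := Measure.pi ν) (X := fun x => s / l * Z x) (t := l)
      (δ * τ) hl0 (by simp only [e]; exact hi)
    refine this.trans ?_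
    rw [mgf]
    simp only [e]
    calc _ ≤ Real.exp (-l * (δ * τ)) * Real.exp (256 * M ^ 2 * σ * τ * s ^ 2) := by
          gcongr
          exact integral_exp_quadForm_le hM hL hLM hσ h hX hX' hs1
      _ = _ := by
          rw [← Real.exp_add, ← sq_abs s, hs, hl]
          congr 1
          field_simp
          ring
  rcases eq_or_lt_of_le hl0 with h0 | h0
  · have : δ = 0 := by
      rw [hl, eq_comm, div_eq_zero_iff] at h0
      exact h0.resolve_right (by positivity)
    rw [this]
    calc _ ≤ (1 : ℝ) := measureReal_le_one
      _ ≤ _ := by simp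
  · have h1 := (hb l (abs_of_pos h0)).resolve_right h0.ne'
    have h2 := (hb (-l) (by rw [abs_neg, abs_of_pos h0])).resolve_right h0.ne'
    rw [two_mul]
    refine (measureReal_mono ?_).trans ((measureReal_union_le _ _).trans (add_le_add h1 h2))
    intro x hx
    simp only [Set.mem_ofPred_eq, Set.mem_union, neg_div, div_self h0.ne', one_mul, neg_mul] at hx ⊢
    exact le_abs.1 hx

end HansonWright

/-! ### Nets, sparse vectors and counting -/

/-- The unit ball of a finite-dimensional real normed space has a `1/2`-net of at most
`5 ^ finrank` points. -/
theorem exists_half_net (V : Type*) [NormedAddCommGroup V] [NormedSpace ℝ V]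
    [FiniteDimensional ℝ V] :
    ∃ N : Finset V, N.card ≤ 5 ^ Module.finrank ℝ V ∧ (∀ x ∈ N, ‖x‖ ≤ 1) ∧
      ∀ u : V, ‖u‖ ≤ 1 → ∃ x ∈ N, ‖u - x‖ ≤ 1 / 2 := by
  classical
  -- A `1`-separated set of maximal size in the ball of radius `2` is a `1`-net there; halving it
  -- gives the net of the unit ball.
  let P : ℕ → Prop := fun m => ∃ s : Finset V, s.card = m ∧ (∀ c ∈ s, ‖c‖ ≤ 2) ∧
    ∀ c ∈ s, ∀ d ∈ s, c ≠ d → 1 ≤ ‖c - d‖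
  have hP : ∀ m, P m → m ≤ 5 ^ Module.finrank ℝ V := by
    rintro m ⟨s, rfl, h1, h2⟩
    exact Besicovitch.card_le_of_separated s h1 h2
  have h0 : P 0 := ⟨∅, by simp⟩
  obtain ⟨s, hs, h1, h2⟩ := Nat.findGreatest_spec (P := P)
    (Nat.zero_le (5 ^ Module.finrank ℝ V)) h0
  have hmax : ∀ v : V, ‖v‖ ≤ 2 → ∃ c ∈ s, ‖v - c‖ ≤ 1 := by
    intro v hv
    by_contra! hcon
    have hvs : v ∉ s := fun h => by
      have := hcon v h
      norm_num at this
    have hP1 : P (s.card + 1) := by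
      refine ⟨insert v s, Finset.card_insert_of_notMem hvs, ?_, ?_⟩
      · intro c hc
        rcases Finset.mem_insert.1 hc with rfl | hc
        exacts [hv, h1 c hc]
      · intro c hc d hd hcd
        rcases Finset.mem_insert.1 hc with rfl | hc' <;> rcases Finset.mem_insert.1 hd with rfl | hd'
        · exact absurd rfl hcd
        · exact (hcon d hd').le
        · rw [norm_sub_rev]
          exact (hcon c hc').le
        · exact h2 c hc' d hd' hcd
    have := Nat.le_findGreatest (hP _ hP1) hP1
    rw [← hs] at this
    exact absurd this (Nat.not_succ_le_self _)
  refine ⟨s.image fun x => (1 / 2 : ℝ) • x, Finset.card_image_le.trans ?_, ?_, ?_⟩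
  · exact Besicovitch.card_le_of_separated s h1 h2
  · intro x hx
    obtain ⟨y, hy, rfl⟩ := Finset.mem_image.1 hx
    rw [norm_smul]
    norm_num
    linarith [h1 y hy]
  · intro u hu
    obtain ⟨c, hc, hd⟩ := hmax ((2 : ℝ) • u) (by rw [norm_smul]; norm_num; linarith)
    refine ⟨_, Finset.mem_image_of_mem _ hc, ?_⟩
    have : u - (1 / 2 : ℝ) • c = (1 / 2 : ℝ) • ((2 : ℝ) • u - c) := by
      rw [smul_sub, smul_smul]
      norm_num
    rw [this, norm_smul]
    norm_num
    linarith

/-- A linear functional is controlled by its values on a `1/2`-net of the unit ball. -/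
theorem abs_le_of_half_net {V : Type*} [NormedAddCommGroup V] [NormedSpace ℝ V]
    [FiniteDimensional ℝ V] {N : Finset V}
    (hN : ∀ u : V, ‖u‖ ≤ 1 → ∃ x ∈ N, ‖u - x‖ ≤ 1 / 2) (f : V →ₗ[ℝ] ℝ) {c : ℝ} (hc : 0 ≤ c)
    (hf : ∀ x ∈ N, |f x| ≤ c) (u : V) : |f u| ≤ 2 * c * ‖u‖ := by
  set g := LinearMap.toContinuousLinearMap f with hg
  -- Half of the norm is absorbed into the left side, so `‖g‖ ≤ 2c`.
  have hle : ‖g‖ ≤ c + ‖g‖ / 2 := by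
    refine ContinuousLinearMap.opNorm_le_of_unit_norm (by positivity) fun x hx => ?_
    obtain ⟨y, hy, hxy⟩ := hN x hx.le
    have h1 : ‖g y‖ ≤ c := hf y hy
    have h2 : ‖g (x - y)‖ ≤ ‖g‖ * (1 / 2) := (g.le_opNorm _).trans (by gcongr)
    calc ‖g x‖ = ‖g y + g (x - y)‖ := by rw [← map_add, add_sub_cancel]
      _ ≤ _ := (norm_add_le _ _).trans (by linarith)
  calc |f u| = ‖g u‖ := rfl
    _ ≤ ‖g‖ * ‖u‖ := g.le_opNorm u
    _ ≤ _ := by gcongr; linarith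

/-- A symmetric bilinear form on a `k`-dimensional Euclidean space is controlled by its quadratic
form on a fixed set of at most `2 * 25 ^ k` vectors. -/
theorem exists_finset_quadratic_control {E : Type*} [NormedAddCommGroup E] [InnerProductSpace ℝ E]
    (V : Submodule ℝ E) [FiniteDimensional ℝ V] {k : ℕ} (hk : Module.finrank ℝ V ≤ k) :
    ∃ T : Finset E, T.card ≤ 2 * 25 ^ k ∧ ∀ B : E →ₗ[ℝ] E →ₗ[ℝ] ℝ, (∀ x y, B x y = B y x) →
      ∀ δ : ℝ, 0 ≤ δ → (∀ v ∈ T, |B v v| ≤ δ * ‖v‖ ^ 2) → ∀ u ∈ V, |B u u| ≤ 4 * δ * ‖u‖ ^ 2 := by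
  classical
  obtain ⟨N, hcard, hN1, hN⟩ := exists_half_net V
  have hcard' : N.card ≤ 5 ^ k := hcard.trans (Nat.pow_le_pow_right (by norm_num) hk)
  -- Sums and differences of net points, so that polarisation recovers `B x y` on the net. The set
  -- is chosen before `B`, as a union bound over random forms requires.
  refine ⟨(N ×ˢ N).image (fun z => (z.1 : E) + z.2) ∪ (N ×ˢ N).image (fun z => (z.1 : E) - z.2),
    ?_, ?_⟩
  · calc _ ≤ (N ×ˢ N).card + (N ×ˢ N).card := (Finset.card_union_le _ _).trans
          (add_le_add Finset.card_image_le Finset.card_image_le)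
      _ = 2 * (N.card * N.card) := by rw [Finset.card_product]; ring
      _ ≤ 2 * (5 ^ k * 5 ^ k) := by gcongr
      _ = _ := by rw [← mul_pow]; norm_num
  · intro B hB δ hδ hT u hu
    have h1 : ∀ x ∈ N, ∀ y ∈ N, |B x y| ≤ δ := by
      intro x hx y hy
      have hp := hT ((x : E) + y) (Finset.mem_union_left _ (Finset.mem_image.2
        ⟨(x, y), Finset.mk_mem_product hx hy, rfl⟩))
      have hm := hT ((x : E) - y) (Finset.mem_union_right _ (Finset.mem_image.2
        ⟨(x, y), Finset.mk_mem_product hx hy, rfl⟩))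
      have hpar := parallelogram_law_with_norm ℝ (x : E) y
      have e : B ((x : E) + y) ((x : E) + y) - B ((x : E) - y) ((x : E) - y) = 4 * B x y := by
        simp only [map_add, map_sub, LinearMap.add_apply, LinearMap.sub_apply, hB (y : E) x]
        ring
      have hx1 : ‖(x : E)‖ ≤ 1 := hN1 x hx
      have hy1 : ‖(y : E)‖ ≤ 1 := hN1 y hy
      have hs : ‖(x : E) + y‖ ^ 2 + ‖(x : E) - y‖ ^ 2 ≤ 4 := by
        nlinarith [norm_nonneg (x : E), norm_nonneg (y : E)]
      have hs2 := mul_le_mul_of_nonneg_left hs hδ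
      rw [abs_le] at hp hm ⊢
      constructor <;> nlinarith
    have h2 : ∀ y ∈ N, ∀ v : V, |B v y| ≤ 2 * δ * ‖v‖ := fun y hy v =>
      abs_le_of_half_net hN ((B.flip y).comp V.subtype) hδ (fun x hx => h1 x hx y hy) v
    -- Passing from the net to the ball costs a factor `2` in each argument, hence the `4`.
    have h3 := abs_le_of_half_net hN ((B u).comp V.subtype) (c := 2 * δ * ‖u‖) (by positivity)
      (fun y hy => h2 y hy ⟨u, hu⟩) ⟨u, hu⟩
    calc |B u u| ≤ 2 * (2 * δ * ‖u‖) * ‖u‖ := h3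
      _ = _ := by ring

/-- The vectors supported in `S`. -/
noncomputable def supportedIn {d : ℕ} (S : Finset (Fin d)) :
    Submodule ℝ (EuclideanSpace ℝ (Fin d)) :=
  Submodule.span ℝ (S.image fun i => EuclideanSpace.single i (1 : ℝ))

theorem finrank_supportedIn_le {d : ℕ} (S : Finset (Fin d)) :
    Module.finrank ℝ (supportedIn S) ≤ S.card :=
  (finrank_span_finset_le_card _).trans Finset.card_image_le

theorem exists_mem_supportedIn_of_isSparse {d k : ℕ} (hkd : k ≤ d)
    {u : EuclideanSpace ℝ (Fin d)} (hu : IsSparse k u) :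
    ∃ S ∈ Finset.powersetCard k (Finset.univ : Finset (Fin d)), u ∈ supportedIn S := by
  classical
  have hc : (Finset.univ.filter fun i => u i ≠ 0).card ≤ k := by
    rw [IsSparse, Set.ncard_eq_toFinset_card'] at hu
    convert hu using 2
    ext i
    simp
  -- The support is padded to exactly `k` coordinates, so only `d.choose k` subspaces occur.
  obtain ⟨S, hS, hSk⟩ := Finset.exists_superset_card_eq hc (by simpa using hkd)
  refine ⟨S, Finset.mem_powersetCard.2 ⟨Finset.subset_univ S, hSk⟩, ?_⟩
  have : u = ∑ i ∈ S, u i • EuclideanSpace.single i (1 : ℝ) := by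
    ext j
    simp only [WithLp.ofLp_sum, WithLp.ofLp_smul, Finset.sum_apply, Pi.smul_apply, smul_eq_mul,
      PiLp.single_apply, mul_ite, mul_one, mul_zero, Finset.sum_ite_eq]
    split_ifs with hj
    · rfl
    · by_contra h
      exact hj (hS (by simpa using h))
  rw [this]
  exact Submodule.sum_mem _ fun i hi => Submodule.smul_mem _ _
    (Submodule.subset_span (Finset.mem_coe.2 (Finset.mem_image_of_mem _ hi)))

theorem choose_le_exp {d k : ℕ} (hk : 1 ≤ k) (hkd : k ≤ d) :
    (d.choose k : ℝ) ≤ Real.exp (k * (1 + Real.log (d / k))) := by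
  have hk0 : (0 : ℝ) < k := by exact_mod_cast hk
  have hd0 : (0 : ℝ) < d := by exact_mod_cast (show 0 < d by omega)
  have h1 := Real.pow_div_factorial_le_exp (k : ℝ) hk0.le k
  calc (d.choose k : ℝ) ≤ (d : ℝ) ^ k / k.factorial := Nat.choose_le_pow_div k d
    _ = (d / k : ℝ) ^ k * ((k : ℝ) ^ k / k.factorial) := by rw [div_pow]; field_simp
    _ ≤ (d / k : ℝ) ^ k * Real.exp k := by gcongr
    _ = _ := by
      rw [mul_add, mul_one, Real.exp_add, mul_comm, Real.exp_nat_mul, Real.exp_log (by positivity)]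

theorem card_net_mul_le_exp {d k : ℕ} (hk : 1 ≤ k) (hkd : k ≤ d) :
    (d.choose k : ℝ) * (2 * 25 ^ k) * 2 ≤
      Real.exp (7 * (k * max 1 (Real.log (d / k)))) := by
  have hk1 : (1 : ℝ) ≤ k := by exact_mod_cast hk
  have h4 : (2 * 25 ^ k * 2 : ℝ) ≤ Real.exp (5 * k) := by
    calc (2 * 25 ^ k * 2 : ℝ) = 4 ^ 1 * 25 ^ k := by ring
      _ ≤ 4 ^ k * 25 ^ k := by gcongr; norm_num
      _ = 100 ^ k := by rw [← mul_pow]; norm_num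
      _ ≤ (Real.exp 5) ^ k := by
        gcongr
        have := Real.exp_one_gt_d9
        calc (100 : ℝ) ≤ 2.7 ^ 5 := by norm_num
          _ ≤ (Real.exp 1) ^ 5 := by gcongr; linarith
          _ = Real.exp 5 := by rw [← Real.exp_nat_mul]; norm_num
      _ = _ := by rw [← Real.exp_nat_mul]; ring_nf
  calc (d.choose k : ℝ) * (2 * 25 ^ k) * 2 = d.choose k * (2 * 25 ^ k * 2) := by ring
    _ ≤ Real.exp (k * (1 + Real.log (d / k))) * Real.exp (5 * k) := by
      gcongr
      exact choose_le_exp hk hkd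
    _ = Real.exp (k * (6 + Real.log (d / k))) := by rw [← Real.exp_add]; ring_nf
    _ ≤ _ := by
      apply Real.exp_le_exp.2
      have h1 := le_max_left 1 (Real.log (d / k))
      have h2 := le_max_right 1 (Real.log (d / k))
      calc (k : ℝ) * (6 + Real.log (d / k)) ≤ k * (7 * max 1 (Real.log (d / k))) := by
            gcongr; linarith
        _ = _ := by ring

/-! ### Independence of rows and the law of the coordinates of `R u` -/

section Rows

variable {ι κ Ω : Type*} [MeasurableSpace Ω] {μ : Measure Ω} [IsProbabilityMeasure μ]
  {R : Ω → ι → κ → ℝ}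

/-- The rows of a random array with independent entries are independent. -/
theorem iIndepFun_rows (hm : ∀ i j, Measurable fun ω => R ω i j)
    (h : iIndepFun (fun (ij : ι × κ) ω => R ω ij.1 ij.2) μ) :
    iIndepFun (fun i ω => R ω i) μ := by
  have hprob : ∀ i j, IsProbabilityMeasure (μ.map fun ω => R ω i j) :=
    fun i j => Measure.isProbabilityMeasure_map (hm i j).aemeasurable
  have hrow : ∀ i, Measurable fun ω => R ω i := fun i => measurable_pi_iff.2 (hm i)
  rw [iIndepFun_iff_map_fun_eq_infinitePi_map hrow]
  have h1 := (iIndepFun_iff_map_fun_eq_infinitePi_map fun ij : ι × κ => hm ij.1 ij.2).1 h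
  -- The joint law is a product over pairs; currying makes it a product over rows of products, which
  -- are the laws of the rows.
  have h2 := Measure.infinitePi_map_curry fun i j => μ.map fun ω => R ω i j
  have hpair : Measurable fun (ω : Ω) (ij : ι × κ) => R ω ij.1 ij.2 :=
    measurable_pi_iff.2 fun ij => hm ij.1 ij.2
  rw [← h1, Measure.map_map (MeasurableEquiv.measurable _) hpair] at h2
  refine Eq.trans ?_ (h2.trans ?_)
  · rfl
  · congr 1
    ext1 i
    have hi : iIndepFun (fun j ω => R ω i j) μ :=
      h.precomp (g := fun j => (i, j)) fun a b hab => (Prod.mk.inj hab).2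
    exact ((iIndepFun_iff_map_fun_eq_infinitePi_map (hm i)).1 hi).symm

variable [Fintype κ]

/-- A normalised linear combination of independent standardised sub-Gaussian variables has a
sub-Gaussian law. -/
theorem isSubgaussianLaw_map_sum {Y : κ → Ω → ℝ} (hm : ∀ j, Measurable (Y j))
    (hind : iIndepFun Y μ) (h0 : ∀ j, ∫ ω, Y j ω ∂μ = 0) (h1 : ∀ j, ∫ ω, Y j ω ^ 2 ∂μ = 1)
    {L : ℝ} (hL : 0 < L)
    (hexp : ∀ j, ∀ t : ℝ, Integrable (fun ω => Real.exp (t * Y j ω)) μ ∧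
      ∫ ω, Real.exp (t * Y j ω) ∂μ ≤ Real.exp (L * t ^ 2))
    {u : κ → ℝ} (hu : ∑ j, u j ^ 2 = 1) :
    IsSubgaussianLaw (μ.map fun ω => ∑ j, Y j ω * u j) L (24 * L) := by
  -- `HasSubgaussianMGF` bounds by `exp(c t² / 2)`, hence the `2` in the parameter.
  have hsub : ∀ j, HasSubgaussianMGF (fun ω => u j * Y j ω) (2 * L * u j ^ 2).toNNReal μ := by
    intro j
    have e : ∀ t ω, t * (u j * Y j ω) = t * u j * Y j ω := fun t ω => (mul_assoc _ _ _).symm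
    refine ⟨fun t => ?_, fun t => ?_⟩
    · simp only [e]
      exact (hexp j _).1
    · rw [Real.coe_toNNReal _ (by positivity), mgf]
      simp only [e]
      refine ((hexp j _).2).trans_eq ?_
      ring_nf
  have hind' : iIndepFun (fun j ω => u j * Y j ω) μ :=
    hind.comp (fun j y => u j * y) fun j => by fun_prop
  have hsum := HasSubgaussianMGF.sum_of_iIndepFun hind' (s := Finset.univ) (fun j _ => hsub j)
  have hc : ((∑ j, (2 * L * u j ^ 2).toNNReal : NNReal) : ℝ) = 2 * L := by
    rw [NNReal.coe_sum]
    calc _ = ∑ j, 2 * L * u j ^ 2 :=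
          Finset.sum_congr rfl fun j _ => Real.coe_toNNReal _ (by positivity)
      _ = 2 * L := by rw [← Finset.mul_sum, hu, mul_one]
  have hcomm : (fun ω => ∑ j, Y j ω * u j) = fun ω => ∑ j, u j * Y j ω := by
    ext ω
    exact Finset.sum_congr rfl fun j _ => mul_comm _ _
  rw [hcomm]
  set Z : Ω → ℝ := fun ω => ∑ j, u j * Y j ω with hZ
  have hZm : Measurable Z := by
    rw [hZ]
    exact Finset.measurable_sum _ fun j _ => (hm j).const_mul (u j)
  have hZi : ∀ t : ℝ, Integrable (fun ω => Real.exp (t * Z ω)) μ := hsum.integrable_exp_mul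
  have hZle : ∀ t : ℝ, ∫ ω, Real.exp (t * Z ω) ∂μ ≤ Real.exp (L * t ^ 2) := by
    intro t
    refine (hsum.mgf_le t).trans_eq ?_
    rw [hc]
    ring_nf
  have hZmean : ∫ ω, Z ω ∂μ = 0 := by
    rw [hZ, integral_finsetSum _ fun j _ => (hsub j).integrable]
    exact Finset.sum_eq_zero fun j _ => by rw [integral_const_mul, h0, mul_zero]
  have hZvar : ∫ ω, Z ω ^ 2 ∂μ = 1 := by
    rw [← variance_of_integral_eq_zero hZm.aemeasurable hZmean]
    have hv := IndepFun.variance_sum (μ := μ) (X := fun j ω => u j * Y j ω) (s := Finset.univ)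
      (fun j _ => (hsub j).memLp 2) (fun i _ j _ hij => hind'.indepFun hij)
    have e : Z = ∑ j, fun ω => u j * Y j ω := by
      ext ω
      simp [hZ]
    rw [e, hv, ← hu]
    refine Finset.sum_congr rfl fun j _ => ?_
    rw [variance_const_mul, variance_of_integral_eq_zero (hm j).aemeasurable (h0 j), h1, mul_one]
  obtain ⟨hs1, hs2⟩ := integrable_exp_sq_of_exp_mul_le hL hZm.aemeasurable hZi hZle
  constructor
  · rw [integral_map hZm.aemeasurable (by fun_prop)]
    exact hZmean
  · rw [integral_map hZm.aemeasurable (by fun_prop)]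
    exact hZvar
  · intro t
    rw [integrable_map_measure (by fun_prop) hZm.aemeasurable]
    exact hZi t
  · intro t
    rw [integral_map hZm.aemeasurable (by fun_prop)]
    exact hZle t
  · rw [integrable_map_measure (by fun_prop) hZm.aemeasurable]
    exact hs1
  · rw [integral_map hZm.aemeasurable (by fun_prop)]
    exact hs2

end Rows

/-! ### Matrix norms and the deviation for one vector -/

theorem norm_toLp_sq {n : ℕ} (x : Fin n → ℝ) : ‖WithLp.toLp 2 x‖ ^ 2 = x ⬝ᵥ x := by
  rw [EuclideanSpace.real_norm_sq_eq, dotProduct]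
  exact Finset.sum_congr rfl fun i _ => pow_two _

theorem frobNorm_sq {n p : ℕ} (X : Matrix (Fin n) (Fin p) ℝ) :
    frobNorm X ^ 2 = (Xᵀ * X).trace := by
  rw [frobNorm, Matrix.frobenius_norm_def, ← Real.sqrt_eq_rpow, Real.sq_sqrt (by positivity), trace]
  simp only [diag_apply, mul_apply, transpose_apply, Real.norm_eq_abs, Real.rpow_two, sq_abs]
  rw [Finset.sum_comm]
  exact Finset.sum_congr rfl fun i _ => Finset.sum_congr rfl fun j _ => pow_two _

theorem frobNorm_nonneg {n p : ℕ} (X : Matrix (Fin n) (Fin p) ℝ) : 0 ≤ frobNorm X := by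
  rw [frobNorm, Matrix.frobenius_norm_def]
  positivity

open scoped Matrix.Norms.L2Operator in
theorem specNorm_nonneg {n p : ℕ} (X : Matrix (Fin n) (Fin p) ℝ) : 0 ≤ specNorm X := by
  rw [specNorm]
  exact norm_nonneg _

theorem mulVec_dotProduct_self_le {n p : ℕ} (X : Matrix (Fin n) (Fin p) ℝ) (z : Fin p → ℝ) :
    (X *ᵥ z) ⬝ᵥ (X *ᵥ z) ≤ specNorm X ^ 2 * (z ⬝ᵥ z) := by
  have h := Matrix.l2_opNorm_mulVec X (WithLp.toLp 2 z)
  rw [← norm_toLp_sq, ← norm_toLp_sq, ← mul_pow]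
  exact pow_le_pow_left₀ (norm_nonneg _) h 2

theorem vecMul_dotProduct_self_le {n p : ℕ} (X : Matrix (Fin n) (Fin p) ℝ) (u : Fin n → ℝ) :
    (u ᵥ* X) ⬝ᵥ (u ᵥ* X) ≤ specNorm X ^ 2 * (u ⬝ᵥ u) := by
  have h := mulVec_dotProduct_self_le Xᵀ u
  have e : specNorm Xᵀ = specNorm X := by
    rw [← conjTranspose_eq_transpose_of_trivial]
    exact Matrix.l2_opNorm_conjTranspose X
  rwa [e, mulVec_transpose] at h

/-- The **Hanson–Wright inequality** for the norm of `X R v`. -/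
theorem measure_norm_deviation_le {n p d : ℕ} (X : Matrix (Fin n) (Fin p) ℝ) {Ω : Type*}
    [MeasurableSpace Ω] {μ : Measure Ω} [IsProbabilityMeasure μ]
    {R : Ω → Matrix (Fin p) (Fin d) ℝ} {K : ℝ} (hm : ∀ i j, Measurable fun ω => R ω i j)
    (hind : iIndepFun (fun (ij : Fin p × Fin d) (ω : Ω) => R ω ij.1 ij.2) μ)
    (h0 : ∀ i j, ∫ ω, R ω i j ∂μ = 0) (h1 : ∀ i j, ∫ ω, R ω i j ^ 2 ∂μ = 1)
    (hψ : ∀ i j, psi2Norm (fun ω => R ω i j) μ ≤ ENNReal.ofReal K) (hK : 1 / 2 ≤ K ^ 2)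
    (hK0 : 0 < K) (hX : 0 < specNorm X) {δ : ℝ} (hδ : 0 ≤ δ) (hδ1 : δ ≤ 1)
    (v : EuclideanSpace ℝ (Fin d)) :
    μ.real {ω | δ * frobNorm X ^ 2 * ‖v‖ ^ 2 <
      |‖WithLp.toLp 2 ((X * R ω).mulVec v.ofLp)‖ ^ 2 - frobNorm X ^ 2 * ‖v‖ ^ 2|} ≤
      2 * Real.exp (-(δ ^ 2 * stableRank X / (1024 * (288 * K ^ 2) ^ 2))) := by
  rcases eq_or_ne v 0 with rfl | hv
  · have : {ω | δ * frobNorm X ^ 2 * ‖(0 : EuclideanSpace ℝ (Fin d))‖ ^ 2 <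
      |‖WithLp.toLp 2 ((X * R ω).mulVec (0 : EuclideanSpace ℝ (Fin d)).ofLp)‖ ^ 2 -
        frobNorm X ^ 2 * ‖(0 : EuclideanSpace ℝ (Fin d))‖ ^ 2|} = ∅ := by
      ext ω
      simp
    rw [this, measureReal_empty]
    positivity
  have hv0 : 0 < ‖v‖ := norm_pos_iff.2 hv
  set u : Fin d → ℝ := fun j => v j / ‖v‖ with hu
  have hvu : v.ofLp = ‖v‖ • u := by
    ext j
    simp only [hu, Pi.smul_apply, smul_eq_mul]
    field_simp
  have hu1 : ∑ j, u j ^ 2 = 1 := by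
    simp only [hu, div_pow]
    rw [← Finset.sum_div, ← EuclideanSpace.real_norm_sq_eq, div_self (by positivity)]
  have hL : 0 < 12 * K ^ 2 := by positivity
  have hexp : ∀ i j, ∀ t : ℝ, Integrable (fun ω => Real.exp (t * R ω i j)) μ ∧
      ∫ ω, Real.exp (t * R ω i j) ∂μ ≤ Real.exp (12 * K ^ 2 * t ^ 2) := fun i j t => by
    obtain ⟨hi, hle⟩ := integrable_exp_sq_of_psi2Norm_le (hm i j).aemeasurable hK0 (hψ i j)
    exact integral_exp_mul_le_of_exp_sq hL (hm i j).aemeasurable hi hle (h0 i j) t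
  have hrow : iIndepFun (fun i ω => R ω i) μ := iIndepFun_rows hm hind
  have hξ : iIndepFun (fun i ω => ∑ j, R ω i j * u j) μ :=
    hrow.comp (fun _ r => ∑ j, r j * u j) fun i => by fun_prop
  have hξm : ∀ i, Measurable fun ω => ∑ j, R ω i j * u j := fun i =>
    Finset.measurable_sum _ fun j _ => (hm i j).mul_const _
  have hlaw : ∀ i, IsSubgaussianLaw (μ.map fun ω => ∑ j, R ω i j * u j) (12 * K ^ 2)
      (24 * (12 * K ^ 2)) := fun i =>
    isSubgaussianLaw_map_sum (hm i)
      (hind.precomp (g := fun j => (i, j)) fun a b hab => (Prod.mk.inj hab).2) (h0 i) (h1 i) hL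
      (hexp i) hu1
  have hprob : ∀ i, IsProbabilityMeasure (μ.map fun ω => ∑ j, R ω i j * u j) := fun i =>
    Measure.isProbabilityMeasure_map (hξm i).aemeasurable
  -- Here `L = 12 K²`, `M = 24 L = 288 K²` and `σ = ‖X‖²`; the lower bound on `K²` ensures `M ≥ 1`.
  have hHW := measure_quadForm_deviation_le (X := X) (by linarith) hL.le le_rfl
    (pow_pos hX 2) hlaw (mulVec_dotProduct_self_le X) (vecMul_dotProduct_self_le X) hδ hδ1
  rw [← (iIndepFun_iff_map_fun_eq_pi_map fun i => (hξm i).aemeasurable).1 hξ,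
    ← frobNorm_sq] at hHW
  have hmeas : MeasurableSet {x : Fin p → ℝ | δ * frobNorm X ^ 2 ≤
      |(X *ᵥ x) ⬝ᵥ (X *ᵥ x) - frobNorm X ^ 2|} :=
    measurableSet_le measurable_const
      ((continuous_mulVec_dotProduct_self X).sub continuous_const).abs.measurable
  rw [map_measureReal_apply (measurable_pi_iff.2 hξm) hmeas] at hHW
  refine (measureReal_mono ?_).trans (hHW.trans_eq ?_)
  · intro ω hω
    simp only [Set.mem_ofPred_eq, Set.mem_preimage] at hω ⊢
    change δ * frobNorm X ^ 2 ≤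
      |(X *ᵥ (R ω *ᵥ u)) ⬝ᵥ (X *ᵥ (R ω *ᵥ u)) - frobNorm X ^ 2|
    set q := (X *ᵥ (R ω *ᵥ u)) ⬝ᵥ (X *ᵥ (R ω *ᵥ u))
    have e : ‖WithLp.toLp 2 ((X * R ω).mulVec v.ofLp)‖ ^ 2 - frobNorm X ^ 2 * ‖v‖ ^ 2 =
        (q - frobNorm X ^ 2) * ‖v‖ ^ 2 := by
      rw [norm_toLp_sq, hvu, mulVec_smul, smul_dotProduct, dotProduct_smul, ← mulVec_mulVec,
        smul_eq_mul, smul_eq_mul]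
      ring
    rw [e, abs_mul, abs_of_pos (show 0 < ‖v‖ ^ 2 by positivity)] at hω
    exact (lt_of_mul_lt_mul_right hω (by positivity)).le
  · rw [stableRank]
    congr 3
    field_simp
    ring

/-- The exponent `a = 2` of the supremum: variance one forces `2^(-1/2) ≤ K`. -/
theorem half_le_sq_of_psi2Norm_le {Ω : Type*} [MeasurableSpace Ω] {μ : Measure Ω} {x : Ω → ℝ}
    (h2 : ∫ ω, x ω ^ 2 ∂μ = 1) {K : ℝ} (h : psi2Norm x μ ≤ ENNReal.ofReal K) :
    0 < K ∧ 1 / 2 ≤ K ^ 2 := by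
  have hi : Integrable (fun ω => x ω ^ 2) μ := by
    by_contra hcon
    rw [integral_undef hcon] at h2
    exact zero_ne_one h2
  have hl : ∫⁻ ω, ‖x ω‖ₑ ^ (2 : ℝ) ∂μ = 1 := by
    have e : ∀ ω, ‖x ω‖ₑ ^ (2 : ℝ) = ENNReal.ofReal (x ω ^ 2) := by
      intro ω
      rw [← ofReal_norm, ENNReal.ofReal_rpow_of_nonneg (norm_nonneg _) zero_le_two, Real.rpow_two,
        Real.norm_eq_abs, sq_abs]
    simp_rw [e]
    rw [← ofReal_integral_eq_lintegral_ofReal hi (ae_of_all _ fun ω => sq_nonneg _), h2,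
      ENNReal.ofReal_one]
  have h1 : ENNReal.ofReal ((2 : ℝ) ^ (-(1 / 2) : ℝ)) * eLpNorm x (ENNReal.ofReal 2) μ ≤
      ENNReal.ofReal K := (le_iSup₂_of_le (2 : ℝ) one_le_two le_rfl).trans h
  rw [eLpNorm_eq_lintegral_rpow_enorm_toReal (ENNReal.ofReal_pos.2 two_pos).ne'
    ENNReal.ofReal_ne_top, ENNReal.toReal_ofReal zero_le_two, hl, ENNReal.one_rpow, mul_one] at h1
  have hpos : (0 : ℝ) < 2 ^ (-(1 / 2) : ℝ) := by positivity
  have hK : 0 < K := ENNReal.ofReal_pos.1 ((ENNReal.ofReal_pos.2 hpos).trans_le h1)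
  rw [ENNReal.ofReal_le_ofReal_iff hK.le] at h1
  refine ⟨hK, ?_⟩
  calc (1 / 2 : ℝ) = ((2 : ℝ) ^ (-(1 / 2) : ℝ)) ^ 2 := by
        rw [← Real.rpow_natCast, ← Real.rpow_mul zero_le_two]
        norm_num [Real.rpow_neg_one]
    _ ≤ K ^ 2 := by gcongr

/-! ### From quadratic deviations to restricted isometry -/

/-- A quadratic deviation bound on sparse vectors gives the restricted isometry property. -/
theorem hasScaledRIP_of_sq_deviation_le {n d : ℕ} {M : Matrix (Fin n) (Fin d) ℝ} {s ε : ℝ} {k : ℕ}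
    (hs : 0 < s) (hε : 0 ≤ ε)
    (h : ∀ u : EuclideanSpace ℝ (Fin d), ‖u‖ = 1 → IsSparse k u →
      |‖WithLp.toLp 2 (M.mulVec u.ofLp)‖ ^ 2 - s ^ 2| ≤ ε * s ^ 2) :
    HasScaledRIP M s k ε := by
  intro u hu hk
  have h1 := abs_le.1 (h u hu hk)
  set q := ‖WithLp.toLp 2 (M.mulVec u.ofLp)‖ with hq
  have hq0 : 0 ≤ q := norm_nonneg _
  have hεs : 0 ≤ ε * s := by positivity
  constructor
  · by_contra! hlt
    have : q < s := by nlinarith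
    nlinarith [mul_pos (sub_pos.2 hlt) (show 0 < q + s by linarith), mul_nonneg hεs hq0]
  · by_contra! hlt
    have : s < q := by nlinarith
    nlinarith [mul_pos (sub_pos.2 hlt) (show 0 < q + s by linarith), mul_nonneg hεs hq0]

/-- The bilinear form `⟨M u, M v⟩ - s² ⟨u, v⟩`. -/
noncomputable def gramDeviation {n d : ℕ} (M : Matrix (Fin n) (Fin d) ℝ) (s : ℝ) :
    EuclideanSpace ℝ (Fin d) →ₗ[ℝ] EuclideanSpace ℝ (Fin d) →ₗ[ℝ] ℝ :=
  LinearMap.mk₂ ℝ (fun u v => (M *ᵥ u.ofLp) ⬝ᵥ (M *ᵥ v.ofLp) - s ^ 2 * (u.ofLp ⬝ᵥ v.ofLp))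
    (fun u u' v => by simp only [WithLp.ofLp_add, mulVec_add, add_dotProduct]; ring)
    (fun c u v => by
      simp only [WithLp.ofLp_smul, mulVec_smul, smul_dotProduct, smul_eq_mul]; ring)
    (fun u v v' => by simp only [WithLp.ofLp_add, mulVec_add, dotProduct_add]; ring)
    (fun c u v => by
      simp only [WithLp.ofLp_smul, mulVec_smul, dotProduct_smul, smul_eq_mul]; ring)

theorem gramDeviation_comm {n d : ℕ} (M : Matrix (Fin n) (Fin d) ℝ) (s : ℝ)
    (u v : EuclideanSpace ℝ (Fin d)) : gramDeviation M s u v = gramDeviation M s v u := by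
  simp only [gramDeviation, LinearMap.mk₂_apply]
  rw [dotProduct_comm (M *ᵥ u.ofLp), dotProduct_comm u.ofLp]

theorem gramDeviation_self {n d : ℕ} (M : Matrix (Fin n) (Fin d) ℝ) (s : ℝ)
    (u : EuclideanSpace ℝ (Fin d)) : gramDeviation M s u u =
      ‖WithLp.toLp 2 (M.mulVec u.ofLp)‖ ^ 2 - s ^ 2 * ‖u‖ ^ 2 := by
  have e : ‖u‖ ^ 2 = u.ofLp ⬝ᵥ u.ofLp := norm_toLp_sq u.ofLp
  rw [norm_toLp_sq, e]
  simp only [gramDeviation, LinearMap.mk₂_apply]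

/-- There is a set of at most `d.choose k * (2 * 25 ^ k)` vectors on which a quadratic deviation
bound suffices for the restricted isometry property. -/
theorem exists_finset_hasScaledRIP {d k : ℕ} (hkd : k ≤ d) :
    ∃ T : Finset (EuclideanSpace ℝ (Fin d)), T.card ≤ d.choose k * (2 * 25 ^ k) ∧
      ∀ (n : ℕ) (M : Matrix (Fin n) (Fin d) ℝ) (s ε : ℝ), 0 < s → 0 ≤ ε →
        (∀ v ∈ T, |‖WithLp.toLp 2 (M.mulVec v.ofLp)‖ ^ 2 - s ^ 2 * ‖v‖ ^ 2| ≤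
          ε / 4 * s ^ 2 * ‖v‖ ^ 2) → HasScaledRIP M s k ε := by
  classical
  have hT := fun S : Finset (Fin d) =>
    exists_finset_quadratic_control (supportedIn S) (finrank_supportedIn_le S)
  choose T hTcard hT using hT
  refine ⟨(Finset.powersetCard k Finset.univ).biUnion T, ?_, ?_⟩
  · refine (Finset.card_biUnion_le_card_mul _ _ (2 * 25 ^ k) fun S hS => ?_).trans_eq ?_
    · rw [← (Finset.mem_powersetCard.1 hS).2]
      exact hTcard S
    · simp
  · intro n M s ε hs hε h
    refine hasScaledRIP_of_sq_deviation_le hs hε fun u hu hk => ?_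
    obtain ⟨S, hS, huS⟩ := exists_mem_supportedIn_of_isSparse hkd hk
    have := hT S (gramDeviation M s) (gramDeviation_comm M s) (ε / 4 * s ^ 2) (by positivity)
      (fun v hv => by
        rw [gramDeviation_self]
        exact h v (Finset.mem_biUnion.2 ⟨S, hS, hv⟩)) u huS
    rw [gramDeviation_self, hu] at this
    calc _ = |‖WithLp.toLp 2 (M.mulVec u.ofLp)‖ ^ 2 - s ^ 2 * 1 ^ 2| := by ring_nf
      _ ≤ _ := this
      _ = _ := by ring

/-! ### Union bound and choice of constants -/

theorem theorem1 :
    ∃ C c : ℝ, 0 < C ∧ 0 < c ∧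
      ∀ (n p d : ℕ) (X : Matrix (Fin n) (Fin p) ℝ)
        (Ω : Type*) [MeasurableSpace Ω] (μ : Measure Ω) [IsProbabilityMeasure μ]
        (R : Ω → Matrix (Fin p) (Fin d) ℝ) (K ε : ℝ) (k : ℕ),
        (∀ i j, Measurable fun ω => R ω i j) →
        iIndepFun (fun (ij : Fin p × Fin d) (ω : Ω) => R ω ij.1 ij.2) μ →
        (∀ i j, ∫ ω, R ω i j ∂μ = 0) →
        (∀ i j, ∫ ω, R ω i j ^ 2 ∂μ = 1) →
        (∀ i j, psi2Norm (fun ω => R ω i j) μ ≤ ENNReal.ofReal K) →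
        0 < ε → ε < 1 →
        1 ≤ k → k ≤ d →
        C * K ^ 4 * ((k : ℝ) / ε ^ 2) * max 1 (Real.log ((d : ℝ) / (k : ℝ))) ≤ stableRank X →
        1 - Real.exp (-(c * ε ^ 2 * stableRank X / K ^ 4)) ≤
          μ.real {ω | HasScaledRIP (X * R ω) (frobNorm X) k ε} := by
  -- With `δ = ε / 4` the deviation exponent has denominator `16 * 1024 * 288²`; halving it leaves
  -- one half for the union bound. The `7` in `C` is the counting constant.
  obtain ⟨c, hc⟩ : ∃ c : ℝ, c = 1 / (32 * 1024 * 288 ^ 2) := ⟨_, rfl⟩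
  have hc0 : 0 < c := by rw [hc]; norm_num
  refine ⟨7 / c, c, by positivity, hc0, ?_⟩
  intro n p d X Ω _ μ _ R K ε k hm hind h0 h1 hψ hε hε1 hk hkd hsr
  have hsr0 : 0 ≤ stableRank X := by rw [stableRank]; positivity
  rcases eq_or_lt_of_le hsr0 with hz | hpos
  · rw [← hz]
    simp
  have hspec : 0 < specNorm X := by
    refine lt_of_le_of_ne (specNorm_nonneg X) fun h => ?_
    rw [stableRank, ← h] at hpos
    simp at hpos
  have hfrob : 0 < frobNorm X := by
    refine lt_of_le_of_ne (frobNorm_nonneg X) fun h => ?_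
    rw [stableRank, ← h] at hpos
    simp at hpos
  -- The lower bound on `K` needs an actual entry of `R`, so `p` and `d` must be positive.
  have hp : 0 < p := by
    rcases Nat.eq_zero_or_pos p with rfl | hp
    · have := frobNorm_sq X
      rw [trace, Fin.sum_univ_zero] at this
      exact absurd this (by positivity)
    · exact hp
  obtain ⟨hK0, hK⟩ := half_le_sq_of_psi2Norm_le (h1 ⟨0, hp⟩ ⟨0, by omega⟩)
    (hψ ⟨0, hp⟩ ⟨0, by omega⟩)
  obtain ⟨T, hTcard, hT⟩ := exists_finset_hasScaledRIP hkd
  let bad : EuclideanSpace ℝ (Fin d) → Set Ω := fun v => {ω | ε / 4 * frobNorm X ^ 2 * ‖v‖ ^ 2 <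
      |‖WithLp.toLp 2 ((X * R ω).mulVec v.ofLp)‖ ^ 2 - frobNorm X ^ 2 * ‖v‖ ^ 2|}
  set G : Set Ω := {ω | HasScaledRIP (X * R ω) (frobNorm X) k ε} with hG
  -- Covering the whole space, rather than passing to complements, avoids proving `G` measurable.
  have hcover : Set.univ ⊆ G ∪ ⋃ v ∈ T, bad v := by
    intro ω _
    by_cases hω : ω ∈ ⋃ v ∈ T, bad v
    · exact Or.inr hω
    · refine Or.inl (hT n _ _ _ hfrob hε.le fun v hv => ?_)
      by_contra! hlt
      exact hω (Set.mem_biUnion hv hlt)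
  set a : ℝ := c * ε ^ 2 * stableRank X / K ^ 4 with ha
  have hbad : ∀ v, μ.real (bad v) ≤ 2 * Real.exp (-(2 * a)) := by
    intro v
    refine (measure_norm_deviation_le X hm hind h0 h1 hψ hK hK0 hspec (δ := ε / 4) (by linarith)
      (by linarith) v).trans_eq ?_
    rw [ha, hc]
    congr 3
    field_simp
    norm_num
  have hlog : 7 * (k * max 1 (Real.log ((d : ℝ) / k))) ≤ a := by
    calc 7 * (k * max 1 (Real.log ((d : ℝ) / k))) = c * ε ^ 2 * (7 / c * K ^ 4 * ((k : ℝ) / ε ^ 2) *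
          max 1 (Real.log ((d : ℝ) / (k : ℝ)))) / K ^ 4 := by field_simp
      _ ≤ a := by rw [ha]; gcongr
  have hU : μ.real (⋃ v ∈ T, bad v) ≤ Real.exp (-a) := by
    calc _ ≤ ∑ v ∈ T, μ.real (bad v) := measureReal_biUnion_finset_le T bad
      _ ≤ ∑ v ∈ T, 2 * Real.exp (-(2 * a)) := Finset.sum_le_sum fun v _ => hbad v
      _ = T.card * (2 * Real.exp (-(2 * a))) := by rw [Finset.sum_const, nsmul_eq_mul]
      _ ≤ (d.choose k * (2 * 25 ^ k)) * (2 * Real.exp (-(2 * a))) := by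
        gcongr
        exact_mod_cast hTcard
      _ = d.choose k * (2 * 25 ^ k) * 2 * Real.exp (-(2 * a)) := by ring
      _ ≤ Real.exp a * Real.exp (-(2 * a)) := by
        gcongr
        exact (card_net_mul_le_exp hk hkd).trans (Real.exp_le_exp.2 hlog)
      _ = _ := by rw [← Real.exp_add]; ring_nf
  have h1 : (1 : ℝ) ≤ μ.real G + μ.real (⋃ v ∈ T, bad v) := by
    calc (1 : ℝ) = μ.real Set.univ := by simp
      _ ≤ _ := (measureReal_mono hcover).trans (measureReal_union_le _ _)
  linarith
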